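/- Let $\mathbb{K}$ be a commutative field of characteristic $0$. A ternary algebra $(V,\mu)$ over $\mathbb{K}$ is *$\tau_{13}$-totally associative* if $$\mu(\mu(v_1,v_2,v_3),v_4,v_5)=\mu(v_1,\mu(v_4,v_3,v_2),v_5)=\mu(v_1,v_2,\mu(v_3,v_4,v_5))$$ for all $v_1,\dots,v_5\in V$. Let $\Gamma(E)$ be the free symmetric operad in $\mathbb{K}$-vector spaces generated by $E=\langle\mu\rangle\simeq\mathbb{K}[\Sigma_3]$, one ternary operation $\mu$ without symmetries. The operad of ternary $\tau_{13}$-totally associative algebras is $\tau_{13}\text{-}\mathrm{Ass}=\Gamma(E)/(R)$, where $(R)$ is the operadic ideal generated by $$\mu(\mu\otimes I_2)-\mu(I\otimes\mu\cdot\tau_{13}\otimes I),\qquad \mu(\mu\otimes I_2)-\mu(I_2\otimes\mu).$$ Let $\mathcal{P}$ be an operad with a chosen ternary operation $m$. Say that an operad $\mathcal{Q}$ with a chosen ternary operation $n$ is *compatible* with $(\mathcal{P},m)$ if for every $\mathcal{P}$-algebra $A$ and every $\mathcal{Q}$-algebra $B$ the space $A\otimes B$, with the usual product $(a_1\otimes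 b_1,a_2\otimes b_2,a_3\otimes b_3)\mapsto m(a_1,a_2,a_3)\otimes n(b_1,b_2,b_3)$, is a $\mathcal{P}$-algebra, i.e. carries a $\mathcal{P}$-algebra structure in which $m$ acts by this product. The *current operad* $\widetilde{\mathcal{P}}$ is the maximal operad compatible with $(\mathcal{P},m)$: it is generated by its ternary operation, it is compatible with $(\mathcal{P},m)$, and for every operad $\mathcal{Q}'$ with ternary operation $n'$ that is compatible with $(\mathcal{P},m)$ there is a morphism of operads $\widetilde{\mathcal{P}}\to\mathcal{Q}'$ sending the ternary operation of $\widetilde{\mathcal{P}}$ to $n'$ (so that, if $\mathcal{Q}'$ is generated by $n'$, it is a quotient of $\widetilde{\mathcal{P}}$). **Proposition.** The current operad of $\tau_{13}\text{-}\mathrm{Ass}$ (with its generating operation $\mu$) exists and is $\tau_{13}\text{-}\mathrm{Ass}$ itself: $$\widetilde{\tau_{13}\text{-}\mathrm{Ass}}=\tau_{13}\text{-}\mathrm{Ass}.$$ That is, $\tau_{13}\text{-}\mathrm{Ass}$ with the operation $\mu$ is a current operad of itself, and every current operad of $\tau_{13}\text{-}\mathrm{Ass}$ is isomorphic to $\tau_{13}\text{-}\mathrm{Ass}$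 by an isomorphism of operads preserving the ternary operations. -/

import Mathlib

open scoped TensorProduct

universe u

/-- A symmetric operad in `K`-vector spaces, in coordinate-free form: a vector space `obj ι` of
operations for every finite set `ι` of inputs (so `obj (Fin n)` is the arity `n` component, with
its action of the symmetric group given by `map`), a unit, and total compositions, subject to
functoriality, equivariance, unit and associativity laws. -/
structure Operad (K : Type u) [Field K] where
  obj : (ι : Type) → [Finite ι] → Type u
  [addCommGroup : ∀ (ι : Type) [Finite ι], AddCommGroup (obj ι)]
  [module : ∀ (ι : Type) [Finite ι], Module K (obj ι)]
  map : ∀ {ι κ : Type} [Finite ι] [Finite κ], (ι ≃ κ) → (obj ι →ₗ[K] obj κ)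
  one : obj Unit
  comp : ∀ {ι : Type} {κ : ι → Type} [Finite ι] [∀ i, Finite (κ i)],
    obj ι →ₗ[K] MultilinearMap K (fun i => obj (κ i)) (obj (Σ i, κ i))
  map_refl : ∀ {ι : Type} [Finite ι] (p : obj ι), map (Equiv.refl ι) p = p
  map_trans : ∀ {ι κ ν : Type} [Finite ι] [Finite κ] [Finite ν] (e : ι ≃ κ) (f : κ ≃ ν)
    (p : obj ι), map (e.trans f) p = map f (map e p)
  comp_map_left : ∀ {ι ι' : Type} {κ : ι' → Type} [Finite ι] [Finite ι'] [∀ i, Finite (κ i)]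
    (e : ι ≃ ι') (p : obj ι) (q : ∀ i, obj (κ i)),
    comp (map e p) q = map (Equiv.sigmaCongrLeft e) (comp p fun i => q (e i))
  comp_map_right : ∀ {ι : Type} {κ κ' : ι → Type} [Finite ι] [∀ i, Finite (κ i)]
    [∀ i, Finite (κ' i)] (f : ∀ i, κ i ≃ κ' i) (p : obj ι) (q : ∀ i, obj (κ i)),
    comp p (fun i => map (f i) (q i)) = map (Equiv.sigmaCongrRight f) (comp p q)
  one_comp : ∀ {κ : Type} [Finite κ] (q : obj κ),
    comp one (fun _ : Unit => q) = map (Equiv.uniqueSigma fun _ : Unit => κ).symm q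
  comp_one : ∀ {ι : Type} [Finite ι] (p : obj ι),
    comp p (fun _ => one) = map (Equiv.sigmaUnique ι fun _ => Unit).symm p
  assoc : ∀ {ι : Type} {κ : ι → Type} {ν : ∀ i, κ i → Type} [Finite ι] [∀ i, Finite (κ i)]
    [∀ i k, Finite (ν i k)] (p : obj ι) (q : ∀ i, obj (κ i)) (r : ∀ i k, obj (ν i k)),
    comp (comp p q) (fun x : Σ i, κ i => r x.1 x.2)
      = map (Equiv.sigmaAssoc ν).symm (comp p fun i => comp (q i) (r i))

namespace Operad

attribute [instance] Operad.addCommGroup Operad.module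

variable {K : Type u} [Field K]

/-- Morphisms of operads. -/
structure Hom (P Q : Operad K) where
  app : ∀ (ι : Type) [Finite ι], P.obj ι →ₗ[K] Q.obj ι
  app_map : ∀ {ι κ : Type} [Finite ι] [Finite κ] (e : ι ≃ κ) (p : P.obj ι),
    app κ (P.map e p) = Q.map e (app ι p)
  app_one : app Unit P.one = Q.one
  app_comp : ∀ {ι : Type} {κ : ι → Type} [Finite ι] [∀ i, Finite (κ i)]
    (p : P.obj ι) (q : ∀ i, P.obj (κ i)),
    app (Σ i, κ i) (P.comp p q) = Q.comp (app ι p) (fun i => app (κ i) (q i))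

/-- The endomorphism operad of a vector space: `obj ι` is the space of multilinear maps
`V^ι → V`. -/
noncomputable def endo (K : Type u) [Field K] (V : Type u) [AddCommGroup V] [Module K V] :
    Operad K where
  obj ι _ := MultilinearMap K (fun _ : ι => V) V
  map e :=
    { toFun := fun f => f.domDomCongr e
      map_add' := fun _ _ => rfl
      map_smul' := fun _ _ => rfl }
  one := MultilinearMap.ofSubsingleton K V V () LinearMap.id
  comp :=
    { toFun := fun g =>
        { toFun := fun f => g.compMultilinearMap f
          map_update_add' := by
            intro _ f i a b
            ext v
            change g (fun j => (Function.update f i (a + b)) j fun k => v ⟨j, k⟩)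
              = g (fun j => (Function.update f i a) j fun k => v ⟨j, k⟩)
              + g (fun j => (Function.update f i b) j fun k => v ⟨j, k⟩)
            have h : ∀ c : MultilinearMap K (fun _ => V) V,
                (fun j => (Function.update f i c) j fun k => v ⟨j, k⟩)
                = Function.update (fun j => f j fun k => v ⟨j, k⟩) i (c fun k => v ⟨i, k⟩) := by
              intro c
              funext j
              rcases eq_or_ne j i with rfl | hj
              · simp
              · simp [hj]
            rw [h, h, h, add_apply, MultilinearMap.map_update_add]
          map_update_smul' := by
            intro _ f i c a
            ext v
            change g (fun j => (Function.update f i (c • a)) j fun k => v ⟨j, k⟩)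
              = c • g (fun j => (Function.update f i a) j fun k => v ⟨j, k⟩)
            have h : ∀ c : MultilinearMap K (fun _ => V) V,
                (fun j => (Function.update f i c) j fun k => v ⟨j, k⟩)
                = Function.update (fun j => f j fun k => v ⟨j, k⟩) i (c fun k => v ⟨i, k⟩) := by
              intro c
              funext j
              rcases eq_or_ne j i with rfl | hj
              · simp
              · simp [hj]
            rw [h, h, smul_apply, MultilinearMap.map_update_smul] }
      map_add' := fun _ _ => rfl
      map_smul' := fun _ _ => rfl }
  map_refl _ := rfl
  map_trans _ _ _ := rfl
  comp_map_left e p q := by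
    ext v
    change p (fun i => q (e i) fun k => v ⟨e i, k⟩) = p (fun i => q (e i) fun k => v ⟨e i, k⟩)
    rfl
  comp_map_right f p q := rfl
  one_comp q := rfl
  comp_one p := by
    ext v
    rfl
  assoc p q r := rfl

/-- An algebra over `P` with underlying vector space `V` is a morphism from `P` to the
endomorphism operad of `V`. -/
abbrev Algebra (P : Operad K) (V : Type u) [AddCommGroup V] [Module K V] :=
  P.Hom (endo K V)

/-- The multilinear map `V^ι → V` by which an operation acts on an algebra. -/
noncomputable def Algebra.act {P : Operad K} {V : Type u} [AddCommGroup V] [Module K V] (α : P.Algebra V)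
    {ι : Type} [Finite ι] (p : P.obj ι) : MultilinearMap K (fun _ : ι => V) V :=
  (α.app ι p : (endo K V).obj ι)

/-! ### Suboperads, ideals and quotients -/

structure Suboperad (P : Operad K) where
  carrier : ∀ (ι : Type) [Finite ι], Submodule K (P.obj ι)
  map_mem : ∀ {ι κ : Type} [Finite ι] [Finite κ] (e : ι ≃ κ) {p : P.obj ι},
    p ∈ carrier ι → P.map e p ∈ carrier κ
  one_mem : P.one ∈ carrier Unit
  comp_mem : ∀ {ι : Type} {κ : ι → Type} [Finite ι] [∀ i, Finite (κ i)]
    {p : P.obj ι} {q : ∀ i, P.obj (κ i)}, p ∈ carrier ι → (∀ i, q i ∈ carrier (κ i)) →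
    P.comp p q ∈ carrier (Σ i, κ i)

/-- `P` is generated, as an operad, by the single operation `m`. -/
def GeneratedBy (P : Operad K) {ν : Type} [Finite ν] (m : P.obj ν) : Prop :=
  ∀ S : P.Suboperad, m ∈ S.carrier ν → ∀ (ι : Type) [Finite ι], S.carrier ι = ⊤

structure Ideal (P : Operad K) where
  carrier : ∀ (ι : Type) [Finite ι], Submodule K (P.obj ι)
  map_mem : ∀ {ι κ : Type} [Finite ι] [Finite κ] (e : ι ≃ κ) {p : P.obj ι},
    p ∈ carrier ι → P.map e p ∈ carrier κ
  comp_mem_left : ∀ {ι : Type} {κ : ι → Type} [Finite ι] [∀ i, Finite (κ i)]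
    {p : P.obj ι} (q : ∀ i, P.obj (κ i)), p ∈ carrier ι → P.comp p q ∈ carrier (Σ i, κ i)
  comp_mem_right : ∀ {ι : Type} {κ : ι → Type} [Finite ι] [∀ i, Finite (κ i)]
    (p : P.obj ι) {q : ∀ i, P.obj (κ i)} (i : ι), q i ∈ carrier (κ i) →
    P.comp p q ∈ carrier (Σ i, κ i)

/-- The ideal generated by a set of operations: the intersection of all ideals containing it. -/
def Ideal.span (P : Operad K) {ν : Type} [Finite ν] (S : Set (P.obj ν)) : P.Ideal where
  carrier ι _ := ⨅ J : {J : P.Ideal // S ⊆ J.carrier ν}, J.1.carrier ι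
  map_mem {_ _ _ _} e {p} hp := by
    rw [Submodule.mem_iInf] at hp ⊢
    exact fun J => J.1.map_mem e (hp J)
  comp_mem_left {_ _ _ _} {p} q hp := by
    rw [Submodule.mem_iInf] at hp ⊢
    exact fun J => J.1.comp_mem_left q (hp J)
  comp_mem_right {_ _ _ _} p {q} i hq := by
    rw [Submodule.mem_iInf] at hq ⊢
    exact fun J => J.1.comp_mem_right p i (hq J)

theorem Ideal.comp_sub_mem {P : Operad K} (J : P.Ideal) {ι : Type} {κ : ι → Type} [Finite ι]
    [∀ i, Finite (κ i)] {p p' : P.obj ι} {q q' : ∀ i, P.obj (κ i)}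
    (hp : p - p' ∈ J.carrier ι) (hq : ∀ i, q i - q' i ∈ J.carrier (κ i)) :
    P.comp p q - P.comp p' q' ∈ J.carrier (Σ i, κ i) := by
  classical
  have := Fintype.ofFinite ι
  have h1 : P.comp p q - P.comp p' q ∈ J.carrier (Σ i, κ i) := by
    have := J.comp_mem_left q hp
    rwa [map_sub, sub_apply] at this
  have h2 : ∀ s : Finset ι, P.comp p' q - P.comp p' (s.piecewise q' q)
      ∈ J.carrier (Σ i, κ i) := by
    intro s
    induction s using Finset.induction_on with
    | empty => simp
    | insert a s ha ih =>
      have h3 : P.comp p' (s.piecewise q' q) - P.comp p' ((insert a s).piecewise q' q)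
          ∈ J.carrier (Σ i, κ i) := by
        have h4 := J.comp_mem_right p' (q := Function.update (s.piecewise q' q) a (q a - q' a)) a
          (by simpa using hq a)
        rw [MultilinearMap.map_update_sub] at h4
        rw [Finset.piecewise_insert]
        convert h4 using 3
        rw [eq_comm, Function.update_eq_self_iff]
        simp [ha]
      have := add_mem ih h3
      rwa [sub_add_sub_cancel] at this
  have h5 := add_mem h1 (h2 Finset.univ)
  rwa [sub_add_sub_cancel, Finset.piecewise_univ] at h5

/-- The composition of the quotient operad `P / J`, computed on representatives. -/
noncomputable def Ideal.quotComp {P : Operad K} (J : P.Ideal) {ι : Type} {κ : ι → Type}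
    [Finite ι] [∀ i, Finite (κ i)] (p : P.obj ι ⧸ J.carrier ι)
    (q : ∀ i, P.obj (κ i) ⧸ J.carrier (κ i)) :
    P.obj (Σ i, κ i) ⧸ J.carrier (Σ i, κ i) :=
  Submodule.Quotient.mk (P.comp (Quotient.out p) fun i => Quotient.out (q i))

theorem Ideal.quotComp_mk {P : Operad K} (J : P.Ideal) {ι : Type} {κ : ι → Type}
    [Finite ι] [∀ i, Finite (κ i)] (p : P.obj ι) (q : ∀ i, P.obj (κ i)) :
    J.quotComp (Submodule.Quotient.mk p : P.obj ι ⧸ J.carrier ι)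
      (fun i => (Submodule.Quotient.mk (q i) : P.obj (κ i) ⧸ J.carrier (κ i)))
      = Submodule.Quotient.mk (P.comp p q) := by
  refine (Submodule.Quotient.eq _).2 (J.comp_sub_mem ?_ fun i => ?_)
  · exact (Submodule.Quotient.eq _).1 (Quotient.out_eq _)
  · exact (Submodule.Quotient.eq _).1 (Quotient.out_eq _)

theorem Ideal.exists_rep {P : Operad K} (J : P.Ideal) {ι : Type} {κ : ι → Type}
    [∀ i, Finite (κ i)] (q : ∀ i, P.obj (κ i) ⧸ J.carrier (κ i)) :
    ∃ q' : ∀ i, P.obj (κ i), q = fun i => Submodule.Quotient.mk (q' i) :=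
  ⟨fun i => Quotient.out (q i), funext fun i => (Quotient.out_eq (q i)).symm⟩

theorem Ideal.exists_rep₂ {P : Operad K} (J : P.Ideal) {ι : Type} {κ : ι → Type}
    {ν : ∀ i, κ i → Type} [∀ i k, Finite (ν i k)]
    (r : ∀ i k, P.obj (ν i k) ⧸ J.carrier (ν i k)) :
    ∃ r' : ∀ i k, P.obj (ν i k), r = fun i k => Submodule.Quotient.mk (r' i k) :=
  ⟨fun i k => Quotient.out (r i k), funext fun i => funext fun k =>
    (Quotient.out_eq (r i k)).symm⟩

/-- The relabelling maps of the quotient operad `P / J`. -/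
def Ideal.quotMap {P : Operad K} (J : P.Ideal) {ι κ : Type} [Finite ι] [Finite κ] (e : ι ≃ κ) :
    (P.obj ι ⧸ J.carrier ι) →ₗ[K] (P.obj κ ⧸ J.carrier κ) :=
  Submodule.mapQ _ _ (P.map e) fun _ hp => J.map_mem e hp

theorem Ideal.quotMap_mk {P : Operad K} (J : P.Ideal) {ι κ : Type} [Finite ι] [Finite κ]
    (e : ι ≃ κ) (p : P.obj ι) :
    J.quotMap e (Submodule.Quotient.mk p) = Submodule.Quotient.mk (P.map e p) :=
  rfl

/-- The composition of the quotient operad `P / J`, as a linear-multilinear map. -/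
noncomputable def Ideal.quotCompHom {P : Operad K} (J : P.Ideal) {ι : Type} {κ : ι → Type}
    [Finite ι] [∀ i, Finite (κ i)] :
    (P.obj ι ⧸ J.carrier ι) →ₗ[K] MultilinearMap K (fun i => P.obj (κ i) ⧸ J.carrier (κ i))
      (P.obj (Σ i, κ i) ⧸ J.carrier (Σ i, κ i)) where
  toFun := fun p =>
    { toFun := fun q => J.quotComp p q
      map_update_add' := by
        intro _ q i a b
        obtain ⟨p, rfl⟩ := Submodule.Quotient.mk_surjective _ p
        obtain ⟨q, rfl⟩ := J.exists_rep q
        obtain ⟨a, rfl⟩ := Submodule.Quotient.mk_surjective _ a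
        obtain ⟨b, rfl⟩ := Submodule.Quotient.mk_surjective _ b
        have h : ∀ c, Function.update (fun j => (Submodule.Quotient.mk (q j) :
            P.obj _ ⧸ J.carrier _)) i (Submodule.Quotient.mk c)
            = fun j => Submodule.Quotient.mk (Function.update q i c j) := fun c =>
          funext fun j => (Function.apply_update
            (fun j (c : P.obj _) => (Submodule.Quotient.mk c : P.obj _ ⧸ J.carrier _))
            q i c j).symm
        rw [← Submodule.Quotient.mk_add, h, h, h, J.quotComp_mk, J.quotComp_mk, J.quotComp_mk,
          MultilinearMap.map_update_add, Submodule.Quotient.mk_add]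
      map_update_smul' := by
        intro _ q i c a
        obtain ⟨p, rfl⟩ := Submodule.Quotient.mk_surjective _ p
        obtain ⟨q, rfl⟩ := J.exists_rep q
        obtain ⟨a, rfl⟩ := Submodule.Quotient.mk_surjective _ a
        have h : ∀ c, Function.update (fun j => (Submodule.Quotient.mk (q j) :
            P.obj _ ⧸ J.carrier _)) i (Submodule.Quotient.mk c)
            = fun j => Submodule.Quotient.mk (Function.update q i c j) := fun c =>
          funext fun j => (Function.apply_update
            (fun j (c : P.obj _) => (Submodule.Quotient.mk c : P.obj _ ⧸ J.carrier _))
            q i c j).symm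
        rw [← Submodule.Quotient.mk_smul, h, h, J.quotComp_mk, J.quotComp_mk,
          MultilinearMap.map_update_smul, Submodule.Quotient.mk_smul] }
  map_add' := by
    intro a b
    refine MultilinearMap.ext fun q => ?_
    obtain ⟨a, rfl⟩ := Submodule.Quotient.mk_surjective _ a
    obtain ⟨b, rfl⟩ := Submodule.Quotient.mk_surjective _ b
    obtain ⟨q, rfl⟩ := J.exists_rep q
    change J.quotComp _ _ = J.quotComp _ _ + J.quotComp _ _
    rw [← Submodule.Quotient.mk_add, J.quotComp_mk, J.quotComp_mk, J.quotComp_mk, map_add,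
      add_apply, Submodule.Quotient.mk_add]
  map_smul' := by
    intro c a
    refine MultilinearMap.ext fun q => ?_
    obtain ⟨a, rfl⟩ := Submodule.Quotient.mk_surjective _ a
    obtain ⟨q, rfl⟩ := J.exists_rep q
    change J.quotComp _ _ = c • J.quotComp _ _
    rw [← Submodule.Quotient.mk_smul, J.quotComp_mk, J.quotComp_mk, map_smul,
      smul_apply, Submodule.Quotient.mk_smul]

theorem Ideal.quotCompHom_mk {P : Operad K} (J : P.Ideal) {ι : Type} {κ : ι → Type}
    [Finite ι] [∀ i, Finite (κ i)] (p : P.obj ι) (q : ∀ i, P.obj (κ i)) :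
    J.quotCompHom (Submodule.Quotient.mk p : P.obj ι ⧸ J.carrier ι)
      (fun i => (Submodule.Quotient.mk (q i) : P.obj (κ i) ⧸ J.carrier (κ i)))
      = Submodule.Quotient.mk (P.comp p q) :=
  J.quotComp_mk p q

theorem Ideal.quotComp_map_left {P : Operad K} (J : P.Ideal) {ι ι' : Type} {κ : ι' → Type}
    [Finite ι] [Finite ι'] [∀ i, Finite (κ i)] (e : ι ≃ ι') (p : P.obj ι ⧸ J.carrier ι)
    (q : ∀ i, P.obj (κ i) ⧸ J.carrier (κ i)) :
    J.quotCompHom (J.quotMap e p) q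
      = J.quotMap (Equiv.sigmaCongrLeft e) (J.quotCompHom p fun i => q (e i)) := by
  obtain ⟨p, rfl⟩ := Submodule.Quotient.mk_surjective _ p
  obtain ⟨q, rfl⟩ := J.exists_rep q
  rw [J.quotMap_mk, J.quotCompHom_mk, P.comp_map_left,
    J.quotCompHom_mk (κ := fun i => κ (e i)) p fun i => q (e i), J.quotMap_mk]

theorem Ideal.quotComp_map_right {P : Operad K} (J : P.Ideal) {ι : Type} {κ κ' : ι → Type}
    [Finite ι] [∀ i, Finite (κ i)] [∀ i, Finite (κ' i)] (f : ∀ i, κ i ≃ κ' i)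
    (p : P.obj ι ⧸ J.carrier ι) (q : ∀ i, P.obj (κ i) ⧸ J.carrier (κ i)) :
    J.quotCompHom p (fun i => J.quotMap (f i) (q i))
      = J.quotMap (Equiv.sigmaCongrRight f) (J.quotCompHom p q) := by
  obtain ⟨p, rfl⟩ := Submodule.Quotient.mk_surjective _ p
  obtain ⟨q, rfl⟩ := J.exists_rep q
  simp only [J.quotMap_mk]
  rw [J.quotCompHom_mk, J.quotCompHom_mk, P.comp_map_right, J.quotMap_mk]

theorem Ideal.quotComp_assoc {P : Operad K} (J : P.Ideal) {ι : Type} {κ : ι → Type}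
    {ν : ∀ i, κ i → Type} [Finite ι] [∀ i, Finite (κ i)] [∀ i k, Finite (ν i k)]
    (p : P.obj ι ⧸ J.carrier ι) (q : ∀ i, P.obj (κ i) ⧸ J.carrier (κ i))
    (r : ∀ i k, P.obj (ν i k) ⧸ J.carrier (ν i k)) :
    J.quotCompHom (J.quotCompHom p q) (fun x : Σ i, κ i => r x.1 x.2)
      = J.quotMap (Equiv.sigmaAssoc ν).symm
        (J.quotCompHom p fun i => J.quotCompHom (q i) (r i)) := by
  obtain ⟨p, rfl⟩ := Submodule.Quotient.mk_surjective _ p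
  obtain ⟨q, rfl⟩ := J.exists_rep q
  obtain ⟨r, rfl⟩ := J.exists_rep₂ r
  have h : ∀ i, J.quotCompHom (Submodule.Quotient.mk (q i) : P.obj (κ i) ⧸ J.carrier (κ i))
      (fun k => Submodule.Quotient.mk (r i k)) = Submodule.Quotient.mk (P.comp (q i) (r i)) :=
    fun i => J.quotCompHom_mk (q i) (r i)
  simp only [h]
  rw [J.quotCompHom_mk p q, J.quotCompHom_mk p fun i => P.comp (q i) (r i), J.quotMap_mk,
    J.quotCompHom_mk (P.comp p q) fun x : Σ i, κ i => r x.1 x.2, P.assoc]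

/-- The quotient operad `P / J`, with components `P(ι) / J(ι)`. -/
noncomputable def quotient (P : Operad K) (J : P.Ideal) : Operad K where
  obj ι _ := P.obj ι ⧸ J.carrier ι
  map e := J.quotMap e
  one := Submodule.Quotient.mk P.one
  comp := J.quotCompHom
  map_refl p := by
    obtain ⟨p, rfl⟩ := Submodule.Quotient.mk_surjective _ p
    exact congrArg _ (P.map_refl p)
  map_trans e f p := by
    obtain ⟨p, rfl⟩ := Submodule.Quotient.mk_surjective _ p
    exact congrArg _ (P.map_trans e f p)
  comp_map_left := J.quotComp_map_left
  comp_map_right := J.quotComp_map_right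
  one_comp q := by
    obtain ⟨q, rfl⟩ := Submodule.Quotient.mk_surjective _ q
    exact (J.quotCompHom_mk P.one fun _ => q).trans (congrArg _ (P.one_comp q))
  comp_one p := by
    obtain ⟨p, rfl⟩ := Submodule.Quotient.mk_surjective _ p
    exact (J.quotCompHom_mk p fun _ => P.one).trans (congrArg _ (P.comp_one p))
  assoc := J.quotComp_assoc

end Operad

/-! ### The free operad on one ternary operation -/

/-- Planar ternary trees with leaves labelled by `X`. -/
inductive TernaryTree (X : Type) : Type
  | leaf : X → TernaryTree X
  | node : (Fin 3 → TernaryTree X) → TernaryTree X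

namespace TernaryTree

/-- Substitution of trees for the leaves. -/
def bind {X Y : Type} : TernaryTree X → (X → TernaryTree Y) → TernaryTree Y
  | leaf x, f => f x
  | node c, f => node fun j => (c j).bind f

/-- Relabelling of the leaves. -/
def relabel {X Y : Type} (f : X → Y) (t : TernaryTree X) : TernaryTree Y :=
  t.bind fun x => leaf (f x)

open Classical in
/-- The number of leaves with label `x`. -/
noncomputable def occ {X : Type} (x : X) : TernaryTree X → ℕ
  | leaf y => if y = x then 1 else 0
  | node c => ∑ j, (c j).occ x

/-- Every label occurs on exactly one leaf. -/
def Linear {X : Type} (t : TernaryTree X) : Prop := ∀ x, t.occ x = 1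

theorem bind_leaf {X : Type} (t : TernaryTree X) : t.bind leaf = t := by
  induction t with
  | leaf x => rfl
  | node c ih => exact congrArg node (funext ih)

theorem bind_bind {X Y Z : Type} (t : TernaryTree X) (f : X → TernaryTree Y)
    (g : Y → TernaryTree Z) : (t.bind f).bind g = t.bind fun x => (f x).bind g := by
  induction t with
  | leaf x => rfl
  | node c ih => exact congrArg node (funext ih)

theorem relabel_bind {X Y Z : Type} (t : TernaryTree X) (f : X → Y) (g : Y → TernaryTree Z) :
    (t.relabel f).bind g = t.bind fun x => g (f x) :=
  bind_bind t _ g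

theorem bind_relabel {X Y Z : Type} (t : TernaryTree X) (f : X → TernaryTree Y) (g : Y → Z) :
    (t.bind f).relabel g = t.bind fun x => (f x).relabel g :=
  bind_bind t f _

theorem relabel_relabel {X Y Z : Type} (t : TernaryTree X) (f : X → Y) (g : Y → Z) :
    (t.relabel f).relabel g = t.relabel fun x => g (f x) :=
  bind_bind t _ _

theorem occ_relabel {X Y : Type} (f : X → Y) (hf : Function.Injective f) (t : TernaryTree X)
    (x : X) : (t.relabel f).occ (f x) = t.occ x := by
  induction t with
  | leaf y =>
    simp only [relabel, bind, occ]
    by_cases h : y = x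
    · rw [if_pos h, if_pos (congrArg f h)]
    · rw [if_neg h, if_neg fun h' => h (hf h')]
  | node c ih => exact Finset.sum_congr rfl fun j _ => ih j

theorem occ_relabel_of_ne {X Y : Type} (f : X → Y) (y : Y) (hy : ∀ x, f x ≠ y)
    (t : TernaryTree X) : (t.relabel f).occ y = 0 := by
  induction t with
  | leaf x => simp [relabel, bind, occ, hy]
  | node c ih => exact Finset.sum_eq_zero fun j _ => ih j

theorem Linear.relabel {X Y : Type} {t : TernaryTree X} (ht : t.Linear) (e : X ≃ Y) :
    (t.relabel e).Linear := by
  intro y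
  obtain ⟨x, rfl⟩ := e.surjective y
  rw [occ_relabel e e.injective, ht x]

/-- Substitution of a tree labelled by `κ i` for the leaf `i`, for all `i`. -/
def graft {ι : Type} {κ : ι → Type} (t : TernaryTree ι) (s : ∀ i, TernaryTree (κ i)) :
    TernaryTree (Σ i, κ i) :=
  t.bind fun i => (s i).relabel (Sigma.mk i)

theorem occ_graft {ι : Type} {κ : ι → Type} (t : TernaryTree ι) (s : ∀ i, TernaryTree (κ i))
    (i : ι) (k : κ i) : (t.graft s).occ ⟨i, k⟩ = t.occ i * (s i).occ k := by
  induction t with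
  | leaf j =>
    change ((s j).relabel (Sigma.mk j)).occ ⟨i, k⟩ = (leaf j).occ i * (s i).occ k
    by_cases h : j = i
    · subst h
      rw [occ_relabel _ sigma_mk_injective]
      simp [occ]
    · rw [occ_relabel_of_ne]
      · simp [occ, h]
      · intro x hx
        exact h (congrArg Sigma.fst hx)
  | node c ih =>
    change ∑ j, ((c j).graft s).occ ⟨i, k⟩ = (∑ j, (c j).occ i) * (s i).occ k
    rw [Finset.sum_mul]
    exact Finset.sum_congr rfl fun j _ => ih j

theorem Linear.graft {ι : Type} {κ : ι → Type} {t : TernaryTree ι} (ht : t.Linear)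
    {s : ∀ i, TernaryTree (κ i)} (hs : ∀ i, (s i).Linear) : (t.graft s).Linear := by
  rintro ⟨i, k⟩
  rw [occ_graft, ht i, hs i k]

end TernaryTree

/-- Ternary trees whose leaves are labelled bijectively by `ι`. -/
def LinearTree (ι : Type) : Type := {t : TernaryTree ι // t.Linear}

namespace LinearTree

open TernaryTree

def relabel {ι κ : Type} (e : ι ≃ κ) (t : LinearTree ι) : LinearTree κ :=
  ⟨t.1.relabel e, t.2.relabel e⟩

def graft {ι : Type} {κ : ι → Type} (t : LinearTree ι) (s : ∀ i, LinearTree (κ i)) :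
    LinearTree (Σ i, κ i) :=
  ⟨t.1.graft fun i => (s i).1, t.2.graft fun i => (s i).2⟩

/-- The tree with a single leaf and no vertex. -/
def unit : LinearTree Unit := ⟨leaf (), fun _ => by simp [occ]⟩

/-- The tree with one vertex and leaves `0, 1, 2` in this order. -/
def corolla : LinearTree (Fin 3) :=
  ⟨node fun j => leaf j, fun x => by
    simp only [occ]
    exact (Finset.sum_eq_single x (fun j _ hj => if_neg hj) (by simp)).trans (if_pos rfl)⟩

theorem relabel_refl {ι : Type} (t : LinearTree ι) : t.relabel (Equiv.refl ι) = t :=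
  Subtype.ext (bind_leaf t.1)

theorem relabel_trans {ι κ ν : Type} (e : ι ≃ κ) (f : κ ≃ ν) (t : LinearTree ι) :
    t.relabel (e.trans f) = (t.relabel e).relabel f :=
  Subtype.ext (relabel_relabel t.1 e f).symm

theorem graft_relabel_left {ι ι' : Type} {κ : ι' → Type} (e : ι ≃ ι') (t : LinearTree ι)
    (s : ∀ i, LinearTree (κ i)) :
    (t.relabel e).graft s
      = (t.graft fun i => s (e i)).relabel (Equiv.sigmaCongrLeft e) := by
  refine Subtype.ext ?_
  simp only [relabel, graft, TernaryTree.graft, relabel_bind, bind_relabel, relabel_relabel]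
  rfl

theorem graft_relabel_right {ι : Type} {κ κ' : ι → Type} (f : ∀ i, κ i ≃ κ' i)
    (t : LinearTree ι) (s : ∀ i, LinearTree (κ i)) :
    (t.graft fun i => (s i).relabel (f i))
      = (t.graft s).relabel (Equiv.sigmaCongrRight f) := by
  refine Subtype.ext ?_
  simp only [relabel, graft, TernaryTree.graft, bind_relabel, relabel_relabel]
  rfl

theorem unit_graft {κ : Type} (s : LinearTree κ) :
    (unit.graft fun _ : Unit => s) = s.relabel (Equiv.uniqueSigma fun _ : Unit => κ).symm :=
  rfl

theorem graft_unit {ι : Type} (t : LinearTree ι) :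
    (t.graft fun _ => unit) = t.relabel (Equiv.sigmaUnique ι fun _ => Unit).symm :=
  rfl

theorem graft_assoc {ι : Type} {κ : ι → Type} {ν : ∀ i, κ i → Type} (t : LinearTree ι)
    (s : ∀ i, LinearTree (κ i)) (r : ∀ i k, LinearTree (ν i k)) :
    (t.graft s).graft (fun x : Σ i, κ i => r x.1 x.2)
      = (t.graft fun i => (s i).graft (r i)).relabel (Equiv.sigmaAssoc ν).symm := by
  refine Subtype.ext ?_
  simp only [relabel, graft, TernaryTree.graft, relabel_bind, bind_relabel, relabel_relabel,
    bind_bind]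
  rfl

end LinearTree

namespace Operad

variable {K : Type u} [Field K]

open Classical in
/-- The universal multilinear map on free modules: it sends a family of basis vectors `x i` to
the basis vector `x` of the free module on the product. -/
noncomputable def finsuppProd (K : Type u) [Field K] {ι : Type} [Finite ι] (X : ι → Type) :
    MultilinearMap K (fun i => X i →₀ K) ((∀ i, X i) →₀ K) :=
  letI := Fintype.ofFinite ι
  (PiTensorProduct.ofFinsuppEquiv' (R := K) (κ := X)).toLinearMap.compMultilinearMap
    (PiTensorProduct.tprod K)

theorem finsuppProd_single {ι : Type} [Finite ι] (X : ι → Type) (x : ∀ i, X i) :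
    finsuppProd K X (fun i => Finsupp.single (x i) 1) = Finsupp.single x 1 := by
  simp [finsuppProd]

/-- The linear extension of grafting of trees. -/
noncomputable def freeComp (K : Type u) [Field K] {ι : Type} {κ : ι → Type} [Finite ι] :
    (LinearTree ι →₀ K) →ₗ[K]
      MultilinearMap K (fun i => LinearTree (κ i) →₀ K) (LinearTree (Σ i, κ i) →₀ K) :=
  Finsupp.linearCombination K fun t =>
    (Finsupp.lmapDomain K K (LinearTree.graft t)).compMultilinearMap
      (finsuppProd K fun i => LinearTree (κ i))

theorem freeComp_single {ι : Type} {κ : ι → Type} [Finite ι] (t : LinearTree ι)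
    (s : ∀ i, LinearTree (κ i)) :
    freeComp K (Finsupp.single t 1) (fun i => Finsupp.single (s i) 1)
      = Finsupp.single (t.graft s) 1 := by
  simp [freeComp, finsuppProd_single]

/-- The linear extension of relabelling of trees. -/
noncomputable def freeMap (K : Type u) [Field K] {ι κ : Type} (e : ι ≃ κ) :
    (LinearTree ι →₀ K) →ₗ[K] (LinearTree κ →₀ K) :=
  Finsupp.lmapDomain K K (LinearTree.relabel e)

theorem freeMap_single {ι κ : Type} (e : ι ≃ κ) (t : LinearTree ι) :
    freeMap K e (Finsupp.single t 1) = Finsupp.single (t.relabel e) 1 := by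
  simp [freeMap]

theorem linear_ext {X : Type} {N : Type*} [AddCommGroup N] [Module K N]
    {f g : (X →₀ K) →ₗ[K] N} (h : ∀ x, f (Finsupp.single x 1) = g (Finsupp.single x 1)) :
    f = g :=
  Finsupp.lhom_ext' fun x => LinearMap.ext_ring (h x)

theorem multilinear_ext {ι : Type} [Finite ι] {X : ι → Type} {N : Type*} [AddCommGroup N]
    [Module K N] {f g : MultilinearMap K (fun i => X i →₀ K) N}
    (h : ∀ x : ∀ i, X i, f (fun i => Finsupp.single (x i) 1)
      = g (fun i => Finsupp.single (x i) 1)) : f = g :=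
  Module.Basis.ext_multilinear (fun _ => Finsupp.basisSingleOne) fun x => by simpa using h x

/-- Evaluation of multilinear maps at a fixed argument. -/
def evalAt {ι : Type} {M : ι → Type*} {N : Type*} [∀ i, AddCommGroup (M i)]
    [∀ i, Module K (M i)] [AddCommGroup N] [Module K N] (m : ∀ i, M i) :
    MultilinearMap K M N →ₗ[K] N where
  toFun f := f m
  map_add' _ _ := rfl
  map_smul' _ _ := rfl

/-- Reindexing of the arguments of a multilinear map along a bijection. -/
def reindex {ι ι' : Type} (e : ι ≃ ι') {M : ι' → Type*} {N : Type*} [∀ i, AddCommGroup (M i)]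
    [∀ i, Module K (M i)] [AddCommGroup N] [Module K N]
    (g : MultilinearMap K (fun i => M (e i)) N) : MultilinearMap K M N where
  toFun m := g fun i => m (e i)
  map_update_add' := by
    classical
    intro _ m i' a b
    obtain ⟨i, rfl⟩ := e.surjective i'
    have h : ∀ c, (fun j => Function.update m (e i) c (e j))
        = Function.update (fun j => m (e j)) i c := fun c => funext fun j => by
      rcases eq_or_ne j i with rfl | hj
      · simp
      · simp [hj]
    rw [h, h, h, MultilinearMap.map_update_add]
  map_update_smul' := by
    classical
    intro _ m i' c a
    obtain ⟨i, rfl⟩ := e.surjective i'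
    have h : ∀ c, (fun j => Function.update m (e i) c (e j))
        = Function.update (fun j => m (e j)) i c := fun c => funext fun j => by
      rcases eq_or_ne j i with rfl | hj
      · simp
      · simp [hj]
    rw [h, h, MultilinearMap.map_update_smul]

theorem freeComp_map_left {ι ι' : Type} {κ : ι' → Type} [Finite ι] [Finite ι'] (e : ι ≃ ι')
    (p : LinearTree ι →₀ K) (q : ∀ i, LinearTree (κ i) →₀ K) :
    freeComp K (freeMap K e p) q
      = freeMap K (Equiv.sigmaCongrLeft e) (freeComp K p fun i => q (e i)) := by
  have h : freeComp K (freeMap K e p)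
      = (freeMap K (Equiv.sigmaCongrLeft e)).compMultilinearMap (reindex e
        (M := fun i => LinearTree (κ i) →₀ K) (freeComp K p)) := by
    refine multilinear_ext fun s => ?_
    have h2 : evalAt (fun i => Finsupp.single (s i) 1) ∘ₗ freeComp K ∘ₗ freeMap K e
        = freeMap K (Equiv.sigmaCongrLeft e) ∘ₗ
          evalAt (fun i => Finsupp.single (s (e i)) 1) ∘ₗ
            freeComp K (κ := fun i => κ (e i)) := by
      refine linear_ext fun t => ?_
      change freeComp K (freeMap K _ _) _ = freeMap K _ (freeComp K _ _)
      rw [freeMap_single, freeComp_single, LinearTree.graft_relabel_left, ← freeMap_single]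
      exact congrArg _ (freeComp_single t fun i => s (e i)).symm
    exact LinearMap.congr_fun h2 p
  exact MultilinearMap.congr_fun h q

theorem freeComp_map_right {ι : Type} {κ κ' : ι → Type} [Finite ι] (f : ∀ i, κ i ≃ κ' i)
    (p : LinearTree ι →₀ K) (q : ∀ i, LinearTree (κ i) →₀ K) :
    freeComp K p (fun i => freeMap K (f i) (q i))
      = freeMap K (Equiv.sigmaCongrRight f) (freeComp K p q) := by
  have h : (LinearMap.compMultilinearMap (freeMap K (Equiv.sigmaCongrRight f))
      (freeComp K p)) = (freeComp K p).compLinearMap fun i => freeMap K (f i) := by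
    refine multilinear_ext fun s => ?_
    have h2 : freeMap K (Equiv.sigmaCongrRight f) ∘ₗ
        evalAt (fun i => Finsupp.single (s i) 1) ∘ₗ freeComp K
        = evalAt (fun i => freeMap K (f i) (Finsupp.single (s i) 1)) ∘ₗ freeComp K := by
      refine linear_ext fun t => ?_
      change freeMap K _ (freeComp K _ _) = freeComp K _ fun i => freeMap K _ _
      simp only [freeMap_single]
      rw [freeComp_single, freeComp_single, freeMap_single, LinearTree.graft_relabel_right]
    exact LinearMap.congr_fun h2 p
  exact (MultilinearMap.congr_fun h q).symm

theorem freeComp_assoc {ι : Type} {κ : ι → Type} {ν : ∀ i, κ i → Type} [Finite ι]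
    [∀ i, Finite (κ i)] (p : LinearTree ι →₀ K) (q : ∀ i, LinearTree (κ i) →₀ K)
    (r : ∀ i k, LinearTree (ν i k) →₀ K) :
    freeComp K (freeComp K p q) (fun x : Σ i, κ i => r x.1 x.2)
      = freeMap K (Equiv.sigmaAssoc ν).symm (freeComp K p fun i => freeComp K (q i) (r i)) := by
  have h : freeComp K (freeComp K p q) = (freeMap K (Equiv.sigmaAssoc ν).symm).compMultilinearMap
      ((freeComp K p).compMultilinearMap fun i => freeComp K (κ := ν i) (q i)) := by
    refine multilinear_ext fun r' => ?_
    obtain ⟨r, rfl⟩ : ∃ r : ∀ i k, LinearTree (ν i k), r' = fun x : Σ i, κ i => r x.1 x.2 :=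
      ⟨fun i k => r' ⟨i, k⟩, rfl⟩
    have h1 : (evalAt (fun x : Σ i, κ i => Finsupp.single (r x.1 x.2) 1) ∘ₗ
          freeComp K).compMultilinearMap (freeComp K p)
        = (freeMap K (Equiv.sigmaAssoc ν).symm).compMultilinearMap
          ((freeComp K p).compLinearMap fun i =>
            evalAt (fun k => Finsupp.single (r i k) 1) ∘ₗ freeComp K) := by
      refine multilinear_ext fun s => ?_
      have h2 : evalAt (fun x : Σ i, κ i => Finsupp.single (r x.1 x.2) 1) ∘ₗ freeComp K ∘ₗ
            evalAt (fun i => Finsupp.single (s i) 1) ∘ₗ freeComp K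
          = freeMap K (Equiv.sigmaAssoc ν).symm ∘ₗ evalAt (fun i =>
            freeComp K (Finsupp.single (s i) 1) fun k => Finsupp.single (r i k) 1) ∘ₗ
            freeComp K := by
        refine linear_ext fun t => ?_
        change freeComp K (freeComp K _ _) _ = freeMap K _ (freeComp K _ fun i => freeComp K _ _)
        simp only [freeComp_single]
        rw [freeMap_single, LinearTree.graft_assoc]
      exact LinearMap.congr_fun h2 p
    exact MultilinearMap.congr_fun h1 q
  exact MultilinearMap.congr_fun h fun x => r x.1 x.2

theorem freeComp_comp_one {ι : Type} [Finite ι] (p : LinearTree ι →₀ K) :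
    freeComp K p (fun _ => Finsupp.single LinearTree.unit 1)
      = freeMap K (Equiv.sigmaUnique ι fun _ => Unit).symm p := by
  have h : evalAt (fun _ => Finsupp.single LinearTree.unit 1) ∘ₗ freeComp K
      = freeMap K (Equiv.sigmaUnique ι fun _ => Unit).symm := by
    refine linear_ext fun t => ?_
    change freeComp K _ _ = _
    rw [freeComp_single, freeMap_single, LinearTree.graft_unit]
  exact LinearMap.congr_fun h p

theorem freeComp_one_comp {κ : Type} (q : LinearTree κ →₀ K) :
    freeComp K (Finsupp.single LinearTree.unit 1) (fun _ : Unit => q)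
      = freeMap K (Equiv.uniqueSigma fun _ : Unit => κ).symm q := by
  have h : freeComp K (κ := fun _ => κ) (Finsupp.single LinearTree.unit 1)
      = MultilinearMap.ofSubsingleton K _ _ ()
        (freeMap K (Equiv.uniqueSigma fun _ : Unit => κ).symm) := by
    refine multilinear_ext fun s => ?_
    rw [freeComp_single]
    change _ = freeMap K _ (Finsupp.single (s ()) 1)
    rw [freeMap_single, ← LinearTree.unit_graft]
  exact MultilinearMap.congr_fun h fun _ => q

/-- The free operad `Γ(E)` on `E = ⟨μ⟩ ≅ K[Σ₃]`, concentrated in arity three: the component of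
`ι` has as basis the ternary trees with leaves labelled bijectively by `ι`, and composition is
grafting of trees. -/
noncomputable def free (K : Type u) [Field K] : Operad K where
  obj ι _ := LinearTree ι →₀ K
  map e := freeMap K e
  one := Finsupp.single LinearTree.unit 1
  comp := freeComp K
  map_refl {ι} _ p := by
    have h : freeMap K (Equiv.refl ι) = LinearMap.id :=
      linear_ext fun t => by rw [freeMap_single, LinearTree.relabel_refl]; rfl
    exact LinearMap.congr_fun h p
  map_trans e f p := by
    have h : freeMap K (e.trans f) = freeMap K f ∘ₗ freeMap K e :=
      linear_ext fun t => by
        rw [LinearMap.comp_apply, freeMap_single, freeMap_single, freeMap_single,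
          LinearTree.relabel_trans]
    exact LinearMap.congr_fun h p
  comp_map_left := freeComp_map_left
  comp_map_right := freeComp_map_right
  one_comp := freeComp_one_comp
  comp_one := freeComp_comp_one
  assoc := freeComp_assoc

/-- The generating ternary operation `μ` of the free operad. -/
noncomputable def free.gen (K : Type u) [Field K] : (free K).obj (Fin 3) :=
  (Finsupp.single LinearTree.corolla 1 : LinearTree (Fin 3) →₀ K)

/-! ### The operad of ternary `τ₁₃`-totally associative algebras -/

/-- The tree of `μ(μ(x₀, x₁, x₂), x₃, x₄)`. -/
def treeLeft : LinearTree (Fin 5) :=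
  ⟨.node ![.node ![.leaf 0, .leaf 1, .leaf 2], .leaf 3, .leaf 4], by
    intro x
    fin_cases x <;> simp [TernaryTree.occ, Fin.sum_univ_three]⟩

/-- The tree of `μ(x₀, μ(x₃, x₂, x₁), x₄)`. -/
def treeMiddle : LinearTree (Fin 5) :=
  ⟨.node ![.leaf 0, .node ![.leaf 3, .leaf 2, .leaf 1], .leaf 4], by
    intro x
    fin_cases x <;> simp [TernaryTree.occ, Fin.sum_univ_three]⟩

/-- The tree of `μ(x₀, x₁, μ(x₂, x₃, x₄))`. -/
def treeRight : LinearTree (Fin 5) :=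
  ⟨.node ![.leaf 0, .leaf 1, .node ![.leaf 2, .leaf 3, .leaf 4]], by
    intro x
    fin_cases x <;> simp [TernaryTree.occ, Fin.sum_univ_three]⟩

/-- The relations `μ(μ ⊗ I₂) - μ(I ⊗ μ·τ₁₃ ⊗ I)` and `μ(μ ⊗ I₂) - μ(I₂ ⊗ μ)`. -/
noncomputable def totRelations (K : Type u) [Field K] : Set ((free K).obj (Fin 5)) :=
  {(Finsupp.single treeLeft 1 - Finsupp.single treeMiddle 1 : LinearTree (Fin 5) →₀ K),
    (Finsupp.single treeLeft 1 - Finsupp.single treeRight 1 : LinearTree (Fin 5) →₀ K)}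

/-- The operad `Γ(E)/(R)` of ternary `τ₁₃`-totally associative algebras. -/
noncomputable def tot (K : Type u) [Field K] : Operad K :=
  (free K).quotient (Ideal.span (free K) (totRelations K))

/-- The class in `tot` of the generating operation `μ`. -/
noncomputable def tot.gen (K : Type u) [Field K] : (tot K).obj (Fin 3) :=
  (Submodule.Quotient.mk (free.gen K) :
    (free K).obj (Fin 3) ⧸ (Ideal.span (free K) (totRelations K)).carrier (Fin 3))

/-! ### Current operads -/

/-- For operads `P`, `Q` with ternary operations `m`, `n`: the tensor product of any `P`-algebra
`A` and any `Q`-algebra `B` is a `P`-algebra whose ternary product is the usual product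
`(a₀ ⊗ b₀, a₁ ⊗ b₁, a₂ ⊗ b₂) ↦ m(a₀, a₁, a₂) ⊗ n(b₀, b₁, b₂)`. -/
def TensorCompatible (P : Operad K) (m : P.obj (Fin 3)) (Q : Operad K) (n : Q.obj (Fin 3)) :
    Prop :=
  ∀ (A B : Type u) [AddCommGroup A] [Module K A] [AddCommGroup B] [Module K B]
    (α : P.Algebra A) (β : Q.Algebra B), ∃ γ : P.Algebra (A ⊗[K] B),
      ∀ (a : Fin 3 → A) (b : Fin 3 → B),
        γ.act m (fun i => a i ⊗ₜ[K] b i) = α.act m a ⊗ₜ[K] β.act n b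

/-- `Q`, generated by the ternary operation `n`, is the current operad of `P`, generated by the
ternary operation `m`: it is compatible with `P` and it is maximal for this property, that is,
it maps (compatibly with the ternary operations) to every operad compatible with `P`. In
particular every operad which is generated by one ternary operation and is compatible with `P`
is a quotient of `Q`. -/
def IsCurrentOperad (P : Operad K) (m : P.obj (Fin 3)) (Q : Operad K) (n : Q.obj (Fin 3)) :
    Prop :=
  Q.GeneratedBy n ∧ TensorCompatible P m Q n ∧
    ∀ (Q' : Operad K) (n' : Q'.obj (Fin 3)), TensorCompatible P m Q' n' →
      ∃ φ : Q.Hom Q', φ.app (Fin 3) n = n'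

end Operad

/-! An operad with ternary operation `n` is compatible with `tot` exactly when `n` satisfies the two
defining relations of `tot` (`IsTot`). Since `tot` is presented by these relations, it maps to every
such operad (`exists_tot_hom`); being itself compatible and generated by its operation, it is a
current operad.

Relations imply compatibility, for `Q = tot`: each relation equates one tree monomial with another,
with no sums. On pure tensors a tree monomial in `A ⊗ B` is the tensor of the same monomial in `A`
and in `B` (`value_tensor`), so identities valid in both factors hold in the tensor product
(`IsTot.tensor`).

Compatibility implies relations (`TensorCompatible.isTot`): take `A = K` with the product `xyz`,
which is `τ₁₃`-totally associative because `K` is commutative. Then `K ⊗ B ≅ B` shows that `n` obeys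
the relations in every `Q`-algebra `B`. To conclude in `Q` itself, a `B` is needed on which the
arity five operations act faithfully. It is the space of families of elements of `Q(S)`, for `S` a
subset of a five-element set: an operation distributes its inputs over all ordered partitions of
`S`, empty parts allowed. Applied to units placed at the singletons, an operation returns itself, up
to relabelling, at the full set (`subsetAct_injective`).

Uniqueness is formal: maximality gives morphisms both ways, and their composites fix generators,
hence are identities. -/

namespace TernaryTree

/-! ### Leaves of trees and their labels -/

/-- The type of leaves of a tree. -/
def Leaves {X : Type} : TernaryTree X → Type
  | leaf _ => Unit
  | node c => Σ j, (c j).Leaves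

instance finite_leaves {X : Type} (t : TernaryTree X) : Finite t.Leaves := by
  induction t with
  | leaf x => exact inferInstanceAs (Finite Unit)
  | node c ih => exact inferInstanceAs (Finite (Σ j, (c j).Leaves))

/-- The label of a leaf. -/
def label {X : Type} : (t : TernaryTree X) → t.Leaves → X
  | leaf x, _ => x
  | node c, l => (c l.1).label l.2

/-- The leaves of `t.bind f` are pairs of a leaf of `t` and a leaf of the tree substituted for
it. -/
def bindEquiv {X Y : Type} : (t : TernaryTree X) → (f : X → TernaryTree Y) →
    ((t.bind f).Leaves ≃ Σ l : t.Leaves, (f (t.label l)).Leaves)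
  | leaf x, f => (Equiv.uniqueSigma fun _ : Unit => (f x).Leaves).symm
  | node c, f => (Equiv.sigmaCongrRight fun j => (c j).bindEquiv f).trans
      (Equiv.sigmaAssoc fun j (k : (c j).Leaves) => (f ((c j).label k)).Leaves).symm

theorem label_bind {X Y : Type} (t : TernaryTree X) (f : X → TernaryTree Y)
    (l : (t.bind f).Leaves) :
    (t.bind f).label l = (f (t.label (t.bindEquiv f l).1)).label (t.bindEquiv f l).2 := by
  induction t with
  | leaf x => rfl
  | node c ih => exact ih l.1 l.2

/-- Relabelling does not change the leaves. -/
def relabelEquiv {X Y : Type} (t : TernaryTree X) (f : X → Y) : (t.relabel f).Leaves ≃ t.Leaves :=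
  (t.bindEquiv fun x => leaf (f x)).trans (Equiv.sigmaUnique t.Leaves fun _ => Unit)

theorem label_relabel {X Y : Type} (t : TernaryTree X) (f : X → Y) (l : (t.relabel f).Leaves) :
    (t.relabel f).label l = f (t.label (t.relabelEquiv f l)) :=
  t.label_bind _ l

/-- At a vertex, the fibre of the labelling over `x` is the disjoint union of the fibres in the
three subtrees, which matches the recursion for `occ`. With all counts equal to one, the labelling
is a bijection. -/
theorem card_label_eq {X : Type} (t : TernaryTree X) (x : X) :
    Nat.card {l : t.Leaves // t.label l = x} = t.occ x := by
  classical
  induction t with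
  | leaf y =>
    by_cases h : y = x
    · rw [occ, if_pos h, Nat.card_eq_one_iff_unique]
      exact ⟨⟨fun _ _ => Subtype.ext rfl⟩, ⟨⟨(), h⟩⟩⟩
    · rw [occ, if_neg h, Nat.card_eq_zero]
      exact Or.inl ⟨fun l => h l.2⟩
  | node c ih =>
    rw [occ, ← Finset.sum_congr rfl fun j _ => ih j, ← Nat.card_sigma]
    exact Nat.card_congr
      { toFun := fun l => ⟨l.1.1, l.1.2, l.2⟩
        invFun := fun l => ⟨⟨l.1, l.2.1⟩, l.2.2⟩
        left_inv := fun _ => rfl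
        right_inv := fun _ => rfl }

theorem Linear.label_bijective {X : Type} {t : TernaryTree X} (ht : t.Linear) :
    Function.Bijective t.label := by
  have h : ∀ x, Subsingleton {l : t.Leaves // t.label l = x} ∧
      Nonempty {l : t.Leaves // t.label l = x} := fun x =>
    Nat.card_eq_one_iff_unique.1 ((t.card_label_eq x).trans (ht x))
  refine ⟨fun l k hlk => ?_, fun x => ?_⟩
  · exact congrArg Subtype.val ((h (t.label k)).1.elim ⟨l, hlk⟩ ⟨k, rfl⟩)
  · obtain ⟨l⟩ := (h x).2
    exact ⟨l.1, l.2⟩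

end TernaryTree

/-- The bijection between the leaves and the labels of a linear tree. -/
noncomputable def LinearTree.labelEquiv {ι : Type} (t : LinearTree ι) : t.1.Leaves ≃ ι :=
  Equiv.ofBijective t.1.label t.2.label_bijective

/-! ### Evaluation of trees in an operad and the universal property of the free operad -/

namespace Operad

variable {K : Type u} [Field K]

open TernaryTree

theorem map_comp_eq (P : Operad K) {ι κ ν : Type} [Finite ι] [Finite κ] [Finite ν] (e : ι ≃ κ)
    (f : κ ≃ ν) (g : ι ≃ ν) (h : ∀ i, f (e i) = g i) (p : P.obj ι) :
    P.map f (P.map e p) = P.map g p := by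
  rw [← P.map_trans]
  exact congrArg (fun e => P.map e p) (Equiv.ext h)

theorem map_eq_self (P : Operad K) {ι : Type} [Finite ι] (e : ι ≃ ι) (h : ∀ i, e i = i)
    (p : P.obj ι) : P.map e p = p := by
  obtain rfl : e = Equiv.refl ι := Equiv.ext h
  exact P.map_refl p

theorem map_symm_map (P : Operad K) {ι κ : Type} [Finite ι] [Finite κ] (e : ι ≃ κ)
    (p : P.obj ι) : P.map e.symm (P.map e p) = p := by
  rw [P.map_comp_eq _ _ (Equiv.refl ι) (by simp), P.map_refl]

theorem map_injective (P : Operad K) {ι κ : Type} [Finite ι] [Finite κ] (e : ι ≃ κ) :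
    Function.Injective (P.map e) :=
  Function.LeftInverse.injective (P.map_symm_map e)

/-- The operation obtained from a tree by putting `n` at each of its vertices. -/
def evalTree (P : Operad K) (n : P.obj (Fin 3)) {X : Type} : (t : TernaryTree X) → P.obj t.Leaves
  | leaf _ => P.one
  | node c => P.comp n fun j => P.evalTree n (c j)

/-- By induction on the tree: the unit law handles a leaf, associativity of composition a vertex.
Inputs are indexed by the leaves themselves, so no linearity of the trees is required. -/
theorem map_evalTree_bind (P : Operad K) (n : P.obj (Fin 3)) {X Y : Type} (t : TernaryTree X)
    (f : X → TernaryTree Y) :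
    P.map (t.bindEquiv f) (P.evalTree n (t.bind f))
      = P.comp (P.evalTree n t) fun l => P.evalTree n (f (t.label l)) := by
  induction t with
  | leaf x => exact (P.one_comp _).symm
  | node c ih =>
    refine (P.map_trans _ _ _).trans ?_
    refine Eq.trans ?_ (P.assoc n (fun j => P.evalTree n (c j))
      fun j k => P.evalTree n (f ((c j).label k))).symm
    refine congrArg _ ?_
    refine (P.comp_map_right (fun j => (c j).bindEquiv f) n
      fun j => P.evalTree n ((c j).bind f)).symm.trans ?_
    exact congrArg _ (funext ih)

theorem map_evalTree_relabel (P : Operad K) (n : P.obj (Fin 3)) {X Y : Type} (t : TernaryTree X)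
    (f : X → Y) :
    P.map (t.relabelEquiv f) (P.evalTree n (t.relabel f)) = P.evalTree n t := by
  refine (P.map_trans _ _ _).trans ((congrArg _ (P.map_evalTree_bind n t _)).trans ?_)
  refine (congrArg _ (P.comp_one (P.evalTree n t))).trans ?_
  exact P.map_symm_map (Equiv.sigmaUnique t.Leaves fun _ => Unit).symm _

/-- The operation obtained from a linear tree by putting `n` at each of its vertices. -/
noncomputable def evalLinear (P : Operad K) (n : P.obj (Fin 3)) {ι : Type} [Finite ι]
    (t : LinearTree ι) : P.obj ι :=
  P.map t.labelEquiv (P.evalTree n t.1)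

theorem evalLinear_relabel (P : Operad K) (n : P.obj (Fin 3)) {ι κ : Type} [Finite ι] [Finite κ]
    (e : ι ≃ κ) (t : LinearTree ι) :
    P.evalLinear n (t.relabel e) = P.map e (P.evalLinear n t) := by
  rw [evalLinear, evalLinear, ← P.map_evalTree_relabel n t.1 e, ← P.map_trans, ← P.map_trans]
  exact congrArg (fun e => P.map e _) (Equiv.ext fun l => t.1.label_relabel e l)

theorem evalLinear_graft (P : Operad K) (n : P.obj (Fin 3)) {ι : Type} {κ : ι → Type} [Finite ι]
    [∀ i, Finite (κ i)] (t : LinearTree ι) (s : ∀ i, LinearTree (κ i)) :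
    P.evalLinear n (t.graft s) = P.comp (P.evalLinear n t) fun i => P.evalLinear n (s i) := by
  have h1 : P.comp (P.evalLinear n t) (fun i => P.evalLinear n (s i))
      = P.map (Equiv.sigmaCongrLeft t.labelEquiv)
        (P.comp (P.evalTree n t.1) fun l => P.evalLinear n (s (t.labelEquiv l))) :=
    P.comp_map_left _ _ _
  have h2 : ∀ l, P.evalLinear n (s (t.labelEquiv l))
      = P.map (((s (t.labelEquiv l)).1.relabelEquiv (Sigma.mk (t.labelEquiv l))).trans
        (s (t.labelEquiv l)).labelEquiv)
        (P.evalTree n ((s (t.labelEquiv l)).1.relabel (Sigma.mk (t.labelEquiv l)))) := fun l => by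
    rw [P.map_trans, map_evalTree_relabel, evalLinear]
  rw [h1, funext h2, P.comp_map_right]
  have h3 := P.map_evalTree_bind n t.1 fun i => (s i).1.relabel (Sigma.mk i)
  refine Eq.trans ?_ (congrArg (fun p => P.map _ (P.map _ p)) h3)
  refine Eq.symm ((congrArg _ (P.map_trans _ _ _).symm).trans ((P.map_trans _ _ _).symm.trans ?_))
  -- Both sides are now relabellings of the value of the same grafted tree, so it remains to compare
  -- the two bijections on each leaf.
  refine congrArg (fun e => P.map e _) (Equiv.ext fun l => Eq.symm ?_)
  refine (t.1.label_bind _ l).trans ?_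
  exact TernaryTree.label_relabel _ _ _

theorem evalLinear_unit (P : Operad K) (n : P.obj (Fin 3)) :
    P.evalLinear n LinearTree.unit = P.one :=
  P.map_eq_self (ι := Unit) _ (fun _ => rfl) _

theorem evalLinear_corolla (P : Operad K) (n : P.obj (Fin 3)) :
    P.evalLinear n LinearTree.corolla = n := by
  refine (congrArg _ (P.comp_one n)).trans ?_
  exact (P.map_comp_eq _ _ (Equiv.refl _) (fun _ => rfl) n).trans (P.map_refl n)

/-- The morphism from the free operad determined by the image of the generator. -/
noncomputable def free.lift (P : Operad K) (n : P.obj (Fin 3)) : (free K).Hom P where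
  app ι _ := Finsupp.linearCombination K (P.evalLinear n : LinearTree ι → P.obj ι)
  app_map {ι κ} _ _ e p := by
    have h : Finsupp.linearCombination K (P.evalLinear n : LinearTree κ → P.obj κ) ∘ₗ freeMap K e
        = P.map e ∘ₗ Finsupp.linearCombination K (P.evalLinear n : LinearTree ι → P.obj ι) :=
      linear_ext fun t => by
        simp [freeMap_single, evalLinear_relabel]
    exact LinearMap.congr_fun h p
  app_one := by
    refine (Finsupp.linearCombination_single K 1 LinearTree.unit).trans ?_
    rw [one_smul, evalLinear_unit]
  app_comp {ι κ} _ _ p q := by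
    have h : (Finsupp.linearCombination K
          (P.evalLinear n : LinearTree (Σ i, κ i) → P.obj (Σ i, κ i))).compMultilinearMap
          (freeComp K p)
        = (P.comp (Finsupp.linearCombination K (P.evalLinear n) p)).compLinearMap
          fun i => Finsupp.linearCombination K (P.evalLinear n : LinearTree (κ i) → _) := by
      -- Reduce to basis trees in two stages: first the inner arguments by multilinearity, then,
      -- with these fixed, the outer one by linearity (`h2`). On trees the claim is
      -- `evalLinear_graft`.
      refine multilinear_ext fun s => ?_
      have h2 : Finsupp.linearCombination K (P.evalLinear n) ∘ₗ
            evalAt (fun i => Finsupp.single (s i) 1) ∘ₗ freeComp K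
          = evalAt (fun i => P.evalLinear n (s i)) ∘ₗ P.comp ∘ₗ
            Finsupp.linearCombination K (P.evalLinear n) := by
        refine linear_ext fun t => ?_
        change Finsupp.linearCombination K _ (freeComp K _ _) = P.comp _ _
        rw [freeComp_single]
        simp [evalLinear_graft]
      refine (LinearMap.congr_fun h2 p).trans ?_
      change P.comp _ _ = P.comp _ _
      simp
    exact MultilinearMap.congr_fun h q

theorem free.lift_single (P : Operad K) (n : P.obj (Fin 3)) {ι : Type} [Finite ι]
    (t : LinearTree ι) :
    (free.lift P n).app ι (Finsupp.single t 1 : LinearTree ι →₀ K) = P.evalLinear n t :=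
  (Finsupp.linearCombination_single K 1 t).trans (one_smul _ _)

theorem free.lift_gen (P : Operad K) (n : P.obj (Fin 3)) :
    (free.lift P n).app (Fin 3) (free.gen K) = n :=
  (free.lift_single P n _).trans (P.evalLinear_corolla n)

end Operad

/-! ### The multilinear part of the free algebra and its faithfulness -/

namespace Operad

variable {K : Type u} [Field K]

/-- The families of pairwise disjoint subsets with union `S`. -/
def Parts (ι : Type) {X : Type} (S : Set X) : Type :=
  {T : ι → Set X // (∀ i, T i ⊆ S) ∧ ∀ x ∈ S, ∃! i, x ∈ T i}

instance (ι : Type) {X : Type} [Finite ι] [Finite X] (S : Set X) : Finite (Parts ι S) :=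
  inferInstanceAs (Finite (Subtype _))

noncomputable instance (ι : Type) {X : Type} [Finite ι] [Finite X] (S : Set X) :
    Fintype (Parts ι S) :=
  Fintype.ofFinite _

namespace Parts

variable {ι X : Type} {S : Set X}

/-- A partition of `S` decomposes `S` as a disjoint union. -/
noncomputable def equiv (T : Parts ι S) : (Σ i, T.1 i) ≃ S :=
  Equiv.ofBijective (fun x => ⟨x.2.1, T.2.1 _ x.2.2⟩) (by
    constructor
    · rintro ⟨i, x, hx⟩ ⟨j, y, hy⟩ h
      obtain rfl : x = y := congrArg Subtype.val h
      obtain rfl : i = j := (T.2.2 x (T.2.1 _ hx)).unique hx hy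
      rfl
    · rintro ⟨x, hx⟩
      obtain ⟨i, hi, -⟩ := T.2.2 x hx
      exact ⟨⟨i, x, hi⟩, rfl⟩)

/-- Reindexing of the parts. -/
def congr {κ : Type} (e : ι ≃ κ) (S : Set X) : Parts κ S ≃ Parts ι S where
  toFun T := ⟨fun i => T.1 (e i), fun i => T.2.1 (e i), fun x hx => by
    obtain ⟨k, hk, hk'⟩ := T.2.2 x hx
    exact ⟨e.symm k, by simpa using hk, fun i hi => by simp [← hk' _ hi]⟩⟩
  invFun T := ⟨fun k => T.1 (e.symm k), fun k => T.2.1 (e.symm k), fun x hx => by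
    obtain ⟨i, hi, hi'⟩ := T.2.2 x hx
    exact ⟨e i, by simpa using hi, fun k hk => by simp [← hi' _ hk]⟩⟩
  left_inv T := Subtype.ext (funext fun k => by simp)
  right_inv T := Subtype.ext (funext fun k => by simp)

/-- The partition into one part. -/
def single (S : Set X) : Parts Unit S :=
  ⟨fun _ => S, fun _ => subset_rfl, fun _ hx => ⟨(), hx, fun _ _ => rfl⟩⟩

theorem eq_single (T : Parts Unit S) : T = single S :=
  Subtype.ext (funext fun i => (T.2.1 i).antisymm fun x hx => by
    obtain ⟨j, hj, -⟩ := T.2.2 x hx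
    exact hj)

/-- The refinement of a partition by partitions of its parts. -/
def join {κ : ι → Type} (T : Parts ι S) (U : ∀ i, Parts (κ i) (T.1 i)) : Parts (Σ i, κ i) S :=
  ⟨fun x => (U x.1).1 x.2, fun x => ((U x.1).2.1 x.2).trans (T.2.1 x.1), fun x hx => by
    obtain ⟨i, hi, hi'⟩ := T.2.2 x hx
    obtain ⟨k, hk, hk'⟩ := (U i).2.2 x hi
    refine ⟨⟨i, k⟩, hk, ?_⟩
    rintro ⟨j, l⟩ hl
    obtain rfl := hi' j ((U j).2.1 l hl)
    obtain rfl := hk' l hl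
    rfl⟩

/-- The coarse partition is recovered from a refinement as the unions of its parts over each `i`.
This is the combinatorial form of associativity of the action. -/
theorem join_bijective (κ : ι → Type) (S : Set X) :
    Function.Bijective fun T : Σ T : Parts ι S, ∀ i, Parts (κ i) (T.1 i) => T.1.join T.2 := by
  constructor
  · rintro ⟨⟨T, hT⟩, U⟩ ⟨⟨T', hT'⟩, U'⟩ h
    have h1 : ∀ i k, (U i).1 k = (U' i).1 k := fun i k =>
      congrFun (congrArg Subtype.val h) ⟨i, k⟩
    obtain rfl : T = T' := by
      funext i
      ext x
      constructor
      · intro hx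
        obtain ⟨k, hk, -⟩ := (U i).2.2 x hx
        exact (U' i).2.1 k (h1 i k ▸ hk)
      · intro hx
        obtain ⟨k, hk, -⟩ := (U' i).2.2 x hx
        exact (U i).2.1 k (h1 i k ▸ hk)
    obtain rfl : U = U' := funext fun i => Subtype.ext (funext (h1 i))
    rfl
  · intro T
    refine ⟨⟨⟨fun i => ⋃ k, T.1 ⟨i, k⟩, fun i => Set.iUnion_subset fun k => T.2.1 _,
      fun x hx => ?_⟩, fun i => ⟨fun k => T.1 ⟨i, k⟩, fun k => Set.subset_iUnion (fun k => T.1 ⟨i, k⟩) k,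
      fun x hx => ?_⟩⟩, rfl⟩
    · obtain ⟨⟨i, k⟩, hk, h⟩ := T.2.2 x hx
      refine ⟨i, Set.mem_iUnion.2 ⟨k, hk⟩, fun j hj => ?_⟩
      obtain ⟨l, hl⟩ := Set.mem_iUnion.1 hj
      exact congrArg Sigma.fst (h ⟨j, l⟩ hl)
    · obtain ⟨k, hk⟩ := Set.mem_iUnion.1 hx
      refine ⟨k, hk, fun l hl => ?_⟩
      exact sigma_mk_injective ((T.2.2 x (T.2.1 _ hk)).unique hl hk)

end Parts

/-- The underlying space of the multilinear part of the free algebra on `X`: families of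
operations indexed by the subsets of `X`. -/
abbrev SubsetFamily (P : Operad K) (X : Type) [Finite X] : Type u :=
  ∀ S : Set X, P.obj S

/-- The contribution of a partition `T` of `S` to the component at `S` of the action. -/
noncomputable def subsetActPart (P : Operad K) {X : Type} [Finite X] {ι : Type} [Finite ι]
    {S : Set X} (T : Parts ι S) :
    P.obj ι →ₗ[K] MultilinearMap K (fun _ : ι => P.SubsetFamily X) (P.obj S) where
  toFun p := (P.map T.equiv).compMultilinearMap
    ((P.comp p).compLinearMap fun i => LinearMap.proj (T.1 i))
  map_add' p q := by
    ext b
    simp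
  map_smul' c p := by
    ext b
    simp

/-- The action of operations on families indexed by subsets: the inputs are distributed over all
partitions. -/
noncomputable def subsetAct (P : Operad K) (X : Type) [Finite X] (ι : Type) [Finite ι] :
    P.obj ι →ₗ[K] MultilinearMap K (fun _ : ι => P.SubsetFamily X) (P.SubsetFamily X) where
  toFun p := MultilinearMap.pi fun S => (∑ T : Parts ι S, P.subsetActPart T) p
  map_add' p q := by
    refine MultilinearMap.ext fun b => funext fun S => ?_
    change (∑ T : Parts ι S, P.subsetActPart T) (p + q) b = _
    rw [map_add]
    rfl
  map_smul' c p := by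
    refine MultilinearMap.ext fun b => funext fun S => ?_
    change (∑ T : Parts ι S, P.subsetActPart T) (c • p) b = _
    rw [map_smul]
    rfl

theorem subsetAct_apply (P : Operad K) {X : Type} [Finite X] {ι : Type} [Finite ι]
    (p : P.obj ι) (b : ι → P.SubsetFamily X) (S : Set X) :
    P.subsetAct X ι p b S
      = ∑ T : Parts ι S, P.map T.equiv (P.comp p fun i => b i (T.1 i)) := by
  change (∑ T : Parts ι S, P.subsetActPart T) p b = _
  rw [LinearMap.sum_apply, sum_apply]
  rfl

theorem subsetAct_map (P : Operad K) {X : Type} [Finite X] {ι κ : Type} [Finite ι] [Finite κ]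
    (e : ι ≃ κ) (p : P.obj ι) (b : κ → P.SubsetFamily X) :
    P.subsetAct X κ (P.map e p) b = P.subsetAct X ι p fun i => b (e i) := by
  funext S
  rw [subsetAct_apply, subsetAct_apply]
  refine Fintype.sum_equiv (Parts.congr e S) _ _ fun T => ?_
  rw [P.comp_map_left e p fun k => b k (T.1 k)]
  exact P.map_comp_eq _ _ _ (fun _ => rfl) _

theorem subsetAct_one (P : Operad K) {X : Type} [Finite X] (b : Unit → P.SubsetFamily X) :
    P.subsetAct X Unit P.one b = b () := by
  funext S
  -- A set has only one partition indexed by `Unit`.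
  rw [subsetAct_apply, Fintype.sum_eq_single (Parts.single S) fun T hT => (hT T.eq_single).elim]
  refine (congrArg _ (P.one_comp (b () S))).trans ?_
  exact (P.map_comp_eq _ _ (Equiv.refl S) (fun _ => rfl) _).trans (P.map_refl _)

theorem subsetAct_comp (P : Operad K) {X : Type} [Finite X] {ι : Type} {κ : ι → Type} [Finite ι]
    [∀ i, Finite (κ i)] (p : P.obj ι) (q : ∀ i, P.obj (κ i))
    (b : (Σ i, κ i) → P.SubsetFamily X) :
    P.subsetAct X (Σ i, κ i) (P.comp p q) b
      = P.subsetAct X ι p fun i => P.subsetAct X (κ i) (q i) fun k => b ⟨i, k⟩ := by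
  classical
  have := Fintype.ofFinite ι
  funext S
  -- Partitions indexed by `Σ i, κ i` are summed as a partition indexed by `ι` followed by
  -- partitions of its parts.
  rw [subsetAct_apply, subsetAct_apply,
    ← Fintype.sum_bijective _ (Parts.join_bijective κ S) _ _ fun _ => rfl, Fintype.sum_sigma]
  refine Finset.sum_congr rfl fun T _ => ?_
  simp only [subsetAct_apply]
  -- Expanding a multilinear composition at sums gives one term for each choice of a partition of
  -- every part, matching the inner sum on the other side.
  rw [MultilinearMap.map_sum, map_sum]
  refine Finset.sum_congr rfl fun U _ => ?_
  rw [P.comp_map_right (fun i => (U i).equiv) p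
    fun i => P.comp (q i) fun k => b ⟨i, k⟩ ((U i).1 k)]
  refine (congrArg _ (P.assoc p q fun i k => b ⟨i, k⟩ ((U i).1 k))).trans ?_
  refine (P.map_trans _ _ _).symm.trans (Eq.trans ?_ (P.map_trans _ _ _))
  exact congrArg (fun e => P.map e _) (Equiv.ext fun _ => rfl)

/-- The multilinear part of the free `P`-algebra on `X`. -/
noncomputable def subsetAlgebra (P : Operad K) (X : Type) [Finite X] :
    P.Algebra (P.SubsetFamily X) where
  app ι _ := P.subsetAct X ι
  app_map e p := MultilinearMap.ext fun b => P.subsetAct_map e p b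
  app_one := MultilinearMap.ext fun b => P.subsetAct_one b
  app_comp p q := MultilinearMap.ext fun b => P.subsetAct_comp p q b

/-- The operations of arity `X` act faithfully on the multilinear part of the free algebra on
`X`. -/
theorem subsetAct_injective (P : Operad K) (X : Type) [Finite X] :
    Function.Injective (P.subsetAct X X) := by
  classical
  refine (injective_iff_map_eq_zero _).2 fun p hp => ?_
  let e : ∀ x : X, Unit ≃ ({x} : Set X) := fun x => Equiv.ofUnique _ _
  -- The family `b x` plays the role of the free generator `x`: the unit, supported at the singleton
  -- `{x}`.
  let b : X → P.SubsetFamily X := fun x => Pi.single {x} (P.map (e x) P.one)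
  let T : Parts X (Set.univ : Set X) :=
    ⟨fun x => {x}, fun _ => Set.subset_univ _, fun x _ => ⟨x, rfl, fun y hy => Eq.symm hy⟩⟩
  have h : P.subsetAct X X p b Set.univ = 0 := by
    rw [hp]
    rfl
  -- Only the partition into singletons `{x}` survives, since in any other one some `b x` is
  -- evaluated off its support. The surviving term is `p` composed with units, that is, `p` up to
  -- three bijective relabellings.
  rw [subsetAct_apply, Fintype.sum_eq_single T] at h
  · have h1 : (fun i => b i (T.1 i)) = fun i => P.map (e i) P.one :=
      funext fun i => Pi.single_eq_same _ _
    rw [h1, P.comp_map_right e p fun _ => P.one, P.comp_one] at h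
    exact P.map_injective _ (P.map_injective _ (P.map_injective _
      (h.trans (by simp only [map_zero]))))
  · intro U hU
    obtain ⟨x, hx⟩ : ∃ x, U.1 x ≠ {x} := by
      by_contra! hc
      exact hU (Subtype.ext (funext hc))
    rw [(P.comp p).map_coord_zero x (Pi.single_eq_of_ne hx _), map_zero]

end Operad

/-! ### The operad `tot` by generators and relations -/

namespace TernaryTree

/-- The tree `t` with its leaves labelled by themselves. -/
def standard {X : Type} : (t : TernaryTree X) → LinearTree t.Leaves
  | leaf _ => LinearTree.unit
  | node c => LinearTree.corolla.graft fun j => (c j).standard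

theorem relabel_standard {X : Type} (t : TernaryTree X) : t.standard.1.relabel t.label = t := by
  induction t with
  | leaf x => rfl
  | node c ih =>
    refine congrArg node (funext fun j => Eq.trans ?_ (ih j))
    exact relabel_relabel (c j).standard.1 (fun l => (⟨j, l⟩ : Σ j, (c j).Leaves)) (node c).label

/-- The value of a tree in a set with a ternary operation. -/
def value {X : Type} {V : Type*} (m : (Fin 3 → V) → V) (v : X → V) : TernaryTree X → V
  | leaf x => v x
  | node c => m fun j => (c j).value m v

end TernaryTree

namespace Operad

variable {K : Type u} [Field K]

open TernaryTree

theorem evalTree_free {X : Type} (t : TernaryTree X) :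
    (free K).evalTree (free.gen K) t = (Finsupp.single t.standard 1 : LinearTree t.Leaves →₀ K) := by
  induction t with
  | leaf x => rfl
  | node c ih =>
    refine (congrArg (freeComp K _) (funext ih)).trans ?_
    exact freeComp_single _ _

/-- Each basis tree is an operadic word in the generator. This gives generation of the free operad
and lets the relations be read as equations between values of trees. -/
theorem evalLinear_free {ι : Type} [Finite ι] (t : LinearTree ι) :
    (free K).evalLinear (free.gen K) t = (Finsupp.single t 1 : LinearTree ι →₀ K) := by
  refine (congrArg _ (evalTree_free t.1)).trans ((freeMap_single _ _).trans ?_)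
  exact congrArg (fun t => Finsupp.single t 1) (Subtype.ext t.1.relabel_standard)

theorem Suboperad.evalLinear_mem {P : Operad K} (S : P.Suboperad) {n : P.obj (Fin 3)}
    (hn : n ∈ S.carrier (Fin 3)) {ι : Type} [Finite ι] (t : LinearTree ι) :
    P.evalLinear n t ∈ S.carrier ι := by
  have h : ∀ {X : Type} (t : TernaryTree X), P.evalTree n t ∈ S.carrier t.Leaves := by
    intro X t
    induction t with
    | leaf x => exact S.one_mem
    | node c ih => exact S.comp_mem hn ih
  exact S.map_mem _ (h t.1)

theorem Hom.app_evalLinear {P Q : Operad K} (φ : P.Hom Q) (n : P.obj (Fin 3)) {ι : Type}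
    [Finite ι] (t : LinearTree ι) :
    φ.app ι (P.evalLinear n t) = Q.evalLinear (φ.app (Fin 3) n) t := by
  have h : ∀ {X : Type} (t : TernaryTree X),
      φ.app t.Leaves (P.evalTree n t) = Q.evalTree (φ.app (Fin 3) n) t := by
    intro X t
    induction t with
    | leaf x => exact φ.app_one
    | node c ih => exact (φ.app_comp _ _).trans (congrArg _ (funext ih))
  rw [evalLinear, evalLinear, φ.app_map, h]

/-- Composition of morphisms of operads. -/
def Hom.trans {P Q R : Operad K} (φ : P.Hom Q) (ψ : Q.Hom R) : P.Hom R where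
  app ι _ := ψ.app ι ∘ₗ φ.app ι
  app_map e p := (congrArg _ (φ.app_map e p)).trans (ψ.app_map e _)
  app_one := (congrArg _ φ.app_one).trans ψ.app_one
  app_comp p q := (congrArg _ (φ.app_comp p q)).trans (ψ.app_comp _ _)

/-- The identity morphism. -/
def Hom.refl (P : Operad K) : P.Hom P where
  app _ _ := LinearMap.id
  app_map _ _ := rfl
  app_one := rfl
  app_comp _ _ := rfl

/-- The suboperad on which two morphisms agree. -/
def Hom.equalizer {P Q : Operad K} (φ ψ : P.Hom Q) : P.Suboperad where
  carrier ι _ := LinearMap.eqLocus (φ.app ι) (ψ.app ι)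
  map_mem e p hp := by
    rw [LinearMap.mem_eqLocus] at hp ⊢
    rw [φ.app_map, ψ.app_map, hp]
  one_mem := φ.app_one.trans ψ.app_one.symm
  comp_mem {ι κ _ _ p q} hp hq := by
    have hq' : ∀ i, φ.app (κ i) (q i) = ψ.app (κ i) (q i) := hq
    rw [LinearMap.mem_eqLocus] at hp ⊢
    rw [φ.app_comp, ψ.app_comp, hp, funext hq']

/-- The equalizer of two morphisms is a suboperad; once it contains the generator it is everything.
-/
theorem GeneratedBy.hom_ext {P Q : Operad K} {n : P.obj (Fin 3)} (hn : P.GeneratedBy n)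
    {φ ψ : P.Hom Q} (h : φ.app (Fin 3) n = ψ.app (Fin 3) n) {ι : Type} [Finite ι]
    (p : P.obj ι) : φ.app ι p = ψ.app ι p := by
  have hp : p ∈ (φ.equalizer ψ).carrier ι := by
    rw [hn (φ.equalizer ψ) h ι]
    exact Submodule.mem_top
  exact hp

/-- The kernel of a morphism of operads. -/
def Hom.ker {P Q : Operad K} (φ : P.Hom Q) : P.Ideal where
  carrier ι _ := LinearMap.ker (φ.app ι)
  map_mem e p hp := by
    rw [LinearMap.mem_ker] at hp ⊢
    rw [φ.app_map, hp, map_zero]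
  comp_mem_left {ι κ _ _ p} q hp := by
    rw [LinearMap.mem_ker] at hp ⊢
    rw [φ.app_comp, hp, map_zero]
    rfl
  comp_mem_right {ι κ _ _} p {q} i hq := by
    rw [LinearMap.mem_ker] at hq ⊢
    rw [φ.app_comp]
    exact MultilinearMap.map_coord_zero _ i hq

theorem Ideal.span_le {P : Operad K} {ν : Type} [Finite ν] {S : Set (P.obj ν)} {J : P.Ideal}
    (h : S ⊆ J.carrier ν) (ι : Type) [Finite ι] : (Ideal.span P S).carrier ι ≤ J.carrier ι :=
  iInf_le (fun J : {J : P.Ideal // S ⊆ J.carrier ν} => J.1.carrier ι) ⟨J, h⟩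

theorem Ideal.subset_span {P : Operad K} {ν : Type} [Finite ν] (S : Set (P.obj ν)) :
    S ⊆ (Ideal.span P S).carrier ν := fun _ hp =>
  Submodule.mem_iInf _ |>.2 fun J => J.2 hp

/-- The projection onto a quotient operad. -/
def Ideal.proj {P : Operad K} (J : P.Ideal) : P.Hom (P.quotient J) where
  app ι _ := (J.carrier ι).mkQ
  app_map _ _ := rfl
  app_one := rfl
  app_comp p q := (J.quotCompHom_mk p q).symm

/-- The morphism from a quotient operad induced by a morphism that vanishes on the ideal. -/
def Ideal.lift {P Q : Operad K} (J : P.Ideal) (φ : P.Hom Q)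
    (h : ∀ (ι : Type) [Finite ι], J.carrier ι ≤ φ.ker.carrier ι) : (P.quotient J).Hom Q where
  app ι _ := (J.carrier ι).liftQ (φ.app ι) (h ι)
  app_map e p := by
    obtain ⟨p, rfl⟩ := Submodule.Quotient.mk_surjective _ p
    exact φ.app_map e p
  app_one := φ.app_one
  app_comp p q := by
    obtain ⟨p, rfl⟩ := Submodule.Quotient.mk_surjective _ p
    obtain ⟨q, rfl⟩ := J.exists_rep q
    exact (congrArg _ (J.quotCompHom_mk p q)).trans (φ.app_comp p q)

/-- The preimage under the projection of a suboperad of the quotient is a suboperad upstairs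
containing `n`. -/
theorem GeneratedBy.quotient {P : Operad K} {n : P.obj (Fin 3)} (hn : P.GeneratedBy n)
    (J : P.Ideal) : (P.quotient J).GeneratedBy (J.proj.app (Fin 3) n) := by
  intro S hS ι _
  let S' : P.Suboperad :=
    { carrier := fun ι _ => (S.carrier ι).comap (J.proj.app ι)
      map_mem := fun e p hp => by
        rw [Submodule.mem_comap, J.proj.app_map]
        exact S.map_mem e hp
      one_mem := by
        rw [Submodule.mem_comap, J.proj.app_one]
        exact S.one_mem
      comp_mem := fun {ι κ _ _ p q} hp hq => by
        rw [Submodule.mem_comap, J.proj.app_comp]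
        exact S.comp_mem hp hq }
  refine eq_top_iff.2 fun p _ => ?_
  obtain ⟨p, rfl⟩ := Submodule.Quotient.mk_surjective _ p
  have hp : p ∈ S'.carrier ι := by
    rw [hn S' hS ι]
    exact Submodule.mem_top
  exact hp

theorem free.generatedBy_gen : (free K).GeneratedBy (free.gen K) := by
  intro S hS ι _
  refine eq_top_iff.2 fun p _ => ?_
  have h : ∀ p : LinearTree ι →₀ K, p ∈ S.carrier ι := fun p => by
    induction p using Finsupp.induction_linear with
    | zero => exact zero_mem _
    | add p q hp hq => exact add_mem hp hq
    | single t c =>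
      have := (S.carrier ι).smul_mem c (evalLinear_free (K := K) t ▸ S.evalLinear_mem hS t)
      rwa [← mul_one c, ← smul_eq_mul, ← Finsupp.smul_single]
  exact h p

theorem tot.generatedBy_gen : (tot K).GeneratedBy (tot.gen K) :=
  (free.generatedBy_gen (K := K)).quotient _

/-- The ternary operation `n` satisfies the relations of `τ₁₃`-totally associative algebras. -/
def IsTot (P : Operad K) (n : P.obj (Fin 3)) : Prop :=
  P.evalLinear n treeLeft = P.evalLinear n treeMiddle ∧
    P.evalLinear n treeLeft = P.evalLinear n treeRight

/-- Universal property of the presentation: the kernel of the morphism from the free operad is an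
ideal containing both relations, hence the ideal they generate. -/
theorem exists_tot_hom {P : Operad K} {n : P.obj (Fin 3)} (hn : P.IsTot n) :
    ∃ φ : (tot K).Hom P, φ.app (Fin 3) (tot.gen K) = n := by
  refine ⟨Ideal.lift _ (free.lift P n) fun ι _ => Ideal.span_le ?_ ι, free.lift_gen P n⟩
  rintro p (rfl | rfl)
  · refine (map_sub ((free.lift P n).app (Fin 5)) _ _).trans (sub_eq_zero.2 ?_)
    exact (free.lift_single P n _).trans (hn.1.trans (free.lift_single P n _).symm)
  · refine (map_sub ((free.lift P n).app (Fin 5)) _ _).trans (sub_eq_zero.2 ?_)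
    exact (free.lift_single P n _).trans (hn.2.trans (free.lift_single P n _).symm)

theorem Hom.isTot {P : Operad K} (φ : (tot K).Hom P) : P.IsTot (φ.app (Fin 3) (tot.gen K)) := by
  have h1 : ∀ t : LinearTree (Fin 5), P.evalLinear (φ.app (Fin 3) (tot.gen K)) t
      = φ.app (Fin 5) ((Ideal.span (free K) (totRelations K)).proj.app (Fin 5)
        (Finsupp.single t 1 : LinearTree (Fin 5) →₀ K)) := fun t => by
    rw [← evalLinear_free, Hom.app_evalLinear]
    exact (φ.app_evalLinear (tot.gen K) t).symm
  have h2 : ∀ p q : LinearTree (Fin 5) →₀ K, p - q ∈ totRelations K →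
      (Ideal.span (free K) (totRelations K)).proj.app (Fin 5) p
        = (Ideal.span (free K) (totRelations K)).proj.app (Fin 5) q := fun p q h =>
    (Submodule.Quotient.eq _).2 (Ideal.subset_span _ h)
  constructor
  · rw [h1, h1, h2 _ _ (Or.inl rfl)]
  · rw [h1, h1, h2 _ _ (Or.inr rfl)]

/-! ### Tensor products -/

section TensorProduct

variable {V A B : Type u} [AddCommGroup V] [Module K V] [AddCommGroup A] [Module K A]
  [AddCommGroup B] [Module K B]

/-- Links operadic composition in the endomorphism operad with plain evaluation of nested products,
so that `IsTot` becomes identities between elements. -/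
theorem evalLinear_endo (m : MultilinearMap K (fun _ : Fin 3 => V) V) {ι : Type} [Finite ι]
    (t : LinearTree ι) (v : ι → V) :
    (show MultilinearMap K (fun _ : ι => V) V from (endo K V).evalLinear m t) v
      = t.1.value m v := by
  have h : ∀ {X : Type} (t : TernaryTree X) (v : X → V),
      (show MultilinearMap K (fun _ : t.Leaves => V) V from (endo K V).evalTree m t)
        (fun l => v (t.label l)) = t.value m v := by
    intro X t v
    induction t with
    | leaf x => rfl
    | node c ih => exact congrArg m (funext ih)
  exact h t.1 v

theorem isTot_endo_iff (m : MultilinearMap K (fun _ : Fin 3 => V) V) :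
    (endo K V).IsTot m ↔ ∀ v : Fin 5 → V, treeLeft.1.value m v = treeMiddle.1.value m v ∧
      treeLeft.1.value m v = treeRight.1.value m v := by
  simp only [← evalLinear_endo, forall_and]
  exact and_congr (MultilinearMap.ext_iff (R := K) (M₁ := fun _ : Fin 5 => V) (M₂ := V))
    (MultilinearMap.ext_iff (R := K) (M₁ := fun _ : Fin 5 => V) (M₂ := V))

theorem multilinear_tensor_ext {ι : Type} [Finite ι] {N : Type*} [AddCommGroup N] [Module K N]
    {F G : MultilinearMap K (fun _ : ι => A ⊗[K] B) N}
    (h : ∀ (a : ι → A) (b : ι → B), F (fun i => a i ⊗ₜ b i) = G fun i => a i ⊗ₜ b i) : F = G :=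
  Module.Basis.ext_multilinear (fun _ => (Module.Basis.ofVectorSpace K A).tensorProduct
    (Module.Basis.ofVectorSpace K B)) fun x => by
      simp only [Module.Basis.tensorProduct_apply']
      exact h _ _

/-- The operation is prescribed on the product basis of `A ⊗ B` and then shown to have the expected
value on all pure tensors. -/
theorem exists_tensor_operation {ι : Type} [Finite ι] (f : MultilinearMap K (fun _ : ι => A) A)
    (g : MultilinearMap K (fun _ : ι => B) B) :
    ∃ F : MultilinearMap K (fun _ : ι => A ⊗[K] B) (A ⊗[K] B),
      ∀ (a : ι → A) (b : ι → B), F (fun i => a i ⊗ₜ b i) = f a ⊗ₜ g b := by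
  classical
  have := Fintype.ofFinite ι
  let β := Module.Basis.ofVectorSpace K A
  let β' := Module.Basis.ofVectorSpace K B
  let F : MultilinearMap K (fun _ : ι => A ⊗[K] B) (A ⊗[K] B) :=
    ((Finsupp.linearCombination K fun x : ι → _ × _ =>
      f (fun i => β (x i).1) ⊗ₜ[K] g fun i => β' (x i).2) ∘ₗ
        PiTensorProduct.ofFinsuppEquiv'.toLinearMap).compMultilinearMap
          (PiTensorProduct.tprod K) |>.compLinearMap fun _ => (β.tensorProduct β').repr.toLinearMap
  refine ⟨F, fun a b => ?_⟩
  -- Pass from basis vectors to arbitrary ones one factor at a time: `h1` fixes `b` and reduces `a`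
  -- to basis vectors, `h2` then reduces `b`.
  have h1 : F.compLinearMap (fun i => (TensorProduct.mk K A B).flip (b i))
      = ((TensorProduct.mk K A B).flip (g b)).compMultilinearMap f := by
    refine Module.Basis.ext_multilinear (fun _ => β) fun x => ?_
    have h2 : F.compLinearMap (fun i => TensorProduct.mk K A B (β (x i)))
        = (TensorProduct.mk K A B (f fun i => β (x i))).compMultilinearMap g := by
      refine Module.Basis.ext_multilinear (fun _ => β') fun y => ?_
      change Finsupp.linearCombination K _ (PiTensorProduct.ofFinsuppEquiv'
        (PiTensorProduct.tprod K fun i => (β.tensorProduct β').repr (β (x i) ⊗ₜ β' (y i)))) = _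
      simp [← Module.Basis.tensorProduct_apply]
    exact MultilinearMap.congr_fun h2 b
  exact MultilinearMap.congr_fun h1 a

theorem value_tensor {f : (Fin 3 → A) → A} {g : (Fin 3 → B) → B}
    {F : (Fin 3 → A ⊗[K] B) → A ⊗[K] B}
    (h : ∀ a b, F (fun i => a i ⊗ₜ b i) = f a ⊗ₜ g b) {X : Type} (t : TernaryTree X) (a : X → A)
    (b : X → B) : t.value F (fun x => a x ⊗ₜ b x) = t.value f a ⊗ₜ t.value g b := by
  induction t with
  | leaf x => rfl
  | node c ih => exact (congrArg F (funext ih)).trans (h _ _)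

/-- By multilinearity pure tensors suffice, and there both sides of a relation are single tensors
whose factors agree by the relations in `A` and in `B`. -/
theorem IsTot.tensor {f : MultilinearMap K (fun _ : Fin 3 => A) A}
    {g : MultilinearMap K (fun _ : Fin 3 => B) B}
    {F : MultilinearMap K (fun _ : Fin 3 => A ⊗[K] B) (A ⊗[K] B)} (hf : (endo K A).IsTot f)
    (hg : (endo K B).IsTot g) (h : ∀ a b, F (fun i => a i ⊗ₜ b i) = f a ⊗ₜ g b) :
    (endo K (A ⊗[K] B)).IsTot F := by
  rw [isTot_endo_iff] at hf hg
  constructor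
  · refine multilinear_tensor_ext fun a b => ?_
    refine (evalLinear_endo _ _ _).trans (Eq.trans ?_ (evalLinear_endo _ _ _).symm)
    rw [value_tensor h, value_tensor h, (hf a).1, (hg b).1]
  · refine multilinear_tensor_ext fun a b => ?_
    refine (evalLinear_endo _ _ _).trans (Eq.trans ?_ (evalLinear_endo _ _ _).symm)
    rw [value_tensor h, value_tensor h, (hf a).2, (hg b).2]

end TensorProduct

/-! ### Compatibility with `tot` and the current operad -/

theorem tot.tensorCompatible : TensorCompatible (tot K) (tot.gen K) (tot K) (tot.gen K) := by
  intro A B _ _ _ _ α β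
  obtain ⟨F, hF⟩ := exists_tensor_operation (α.act (tot.gen K)) (β.act (tot.gen K))
  obtain ⟨γ, hγ⟩ := exists_tot_hom (IsTot.tensor (Hom.isTot α) (Hom.isTot β) hF)
  refine ⟨γ, fun a b => ?_⟩
  rw [← hF]
  exact MultilinearMap.congr_fun hγ _

theorem isTot_mkPiAlgebra : (endo K K).IsTot (MultilinearMap.mkPiAlgebra K (Fin 3) K) := by
  refine (isTot_endo_iff _).2 fun v => ?_
  simp only [treeLeft, treeMiddle, treeRight, value, MultilinearMap.mkPiAlgebra_apply,
    Fin.prod_univ_three, Matrix.cons_val]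
  constructor <;> ring

/-- Test compatibility on `A = K` with its triple product and on the multilinear part of the free
`Q`-algebra on five generators; five is the arity of the relations. -/
theorem TensorCompatible.isTot {Q : Operad K} {n : Q.obj (Fin 3)}
    (h : TensorCompatible (tot K) (tot.gen K) Q n) : Q.IsTot n := by
  obtain ⟨α, hα⟩ := exists_tot_hom (isTot_mkPiAlgebra (K := K))
  let β := Q.subsetAlgebra (Fin 5)
  obtain ⟨γ, hγ⟩ := h K (Q.SubsetFamily (Fin 5)) α β
  have hγ' := (isTot_endo_iff _).1 (Hom.isTot γ)
  -- On tensors `1 ⊗ b` every tree monomial has scalar factor `1`, so `K ⊗ B ≅ B` carries the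
  -- product on the tensor algebra to the action of `n`.
  have h1 : ∀ (t : LinearTree (Fin 5)) (b : Fin 5 → Q.SubsetFamily (Fin 5)),
      TensorProduct.lid K _ (t.1.value (γ.act (tot.gen K)) fun i => (1 : K) ⊗ₜ b i)
        = t.1.value (β.act n) b := fun t b => by
    have h2 : ∀ {X : Type} (t : TernaryTree X),
        t.value (MultilinearMap.mkPiAlgebra K (Fin 3) K) (fun _ => (1 : K)) = 1 := by
      intro X t
      induction t with
      | leaf x => rfl
      | node c ih => exact (congrArg _ (funext ih)).trans (by simp)
    rw [value_tensor (f := MultilinearMap.mkPiAlgebra K (Fin 3) K) (g := β.act n) fun a b => ?_,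
      TensorProduct.lid_tmul, h2, one_smul]
    rw [← hα]
    exact hγ a b
  have h3 : (endo K (Q.SubsetFamily (Fin 5))).IsTot (β.act n) :=
    (isTot_endo_iff _).2 fun b => by
      rw [← h1, ← h1, ← h1]
      exact ⟨congrArg _ (hγ' _).1, congrArg _ (hγ' _).2⟩
  -- The relations hold for the action on `B`; faithfulness in arity five lifts them to `Q`.
  have h4 : ∀ t : LinearTree (Fin 5), Q.subsetAct (Fin 5) (Fin 5) (Q.evalLinear n t)
      = (endo K (Q.SubsetFamily (Fin 5))).evalLinear (β.act n) t := fun t =>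
    Hom.app_evalLinear β n t
  constructor
  · exact Q.subsetAct_injective (Fin 5) ((h4 _).trans (h3.1.trans (h4 _).symm))
  · exact Q.subsetAct_injective (Fin 5) ((h4 _).trans (h3.2.trans (h4 _).symm))

theorem tot.isCurrentOperad : IsCurrentOperad (tot K) (tot.gen K) (tot K) (tot.gen K) :=
  ⟨tot.generatedBy_gen, tot.tensorCompatible, fun _ _ h => exists_tot_hom h.isTot⟩

/-- Two current operads of the same operad are isomorphic. -/
theorem IsCurrentOperad.exists_iso {P Q Q' : Operad K} {m : P.obj (Fin 3)} {n : Q.obj (Fin 3)}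
    {n' : Q'.obj (Fin 3)} (h : IsCurrentOperad P m Q n) (h' : IsCurrentOperad P m Q' n') :
    ∃ φ : Q.Hom Q', φ.app (Fin 3) n = n' ∧
      ∀ (ι : Type) [Finite ι], Function.Bijective (φ.app ι) := by
  obtain ⟨φ, hφ⟩ := h.2.2 Q' n' h'.2.1
  obtain ⟨ψ, hψ⟩ := h'.2.2 Q n h.2.1
  refine ⟨φ, hφ, fun ι _ => Function.bijective_iff_has_inverse.2 ⟨ψ.app ι, fun p => ?_,
    fun p => ?_⟩⟩
  -- The composite sends `n` to `n' ` and back to `n`, so it agrees with the identity on a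
  -- generator.
  · exact h.1.hom_ext (φ := φ.trans ψ) (ψ := Hom.refl Q) ((congrArg _ hφ).trans hψ) p
  · exact h'.1.hom_ext (φ := ψ.trans φ) (ψ := Hom.refl Q') ((congrArg _ hψ).trans hφ) p

end Operad

theorem mainTheorem7 {K : Type u} [Field K] [CharZero K] :
    Operad.IsCurrentOperad (Operad.tot K) (Operad.tot.gen K) (Operad.tot K) (Operad.tot.gen K) ∧
      ∀ (Q : Operad K) (n : Q.obj (Fin 3)),
        Operad.IsCurrentOperad (Operad.tot K) (Operad.tot.gen K) Q n →
          ∃ φ : Q.Hom (Operad.tot K), φ.app (Fin 3) n = Operad.tot.gen K ∧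
            ∀ (ι : Type) [Finite ι], Function.Bijective (φ.app ι) :=
  ⟨Operad.tot.isCurrentOperad, fun _ _ h => h.exists_iso Operad.tot.isCurrentOperad⟩
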